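/- \textbf{The REF solution is a standard solution.} Call $C\subset\mathbb{R}^2$ a \emph{bargaining set} if it is compact and convex with non-empty interior. For $0<\varepsilon\le\frac12$ and $n\ge 0$, the \emph{hybrid game} $H^\varepsilon_n$ is the following random two-player extensive form game with perfect information over the complete binary tree of depth $n$. The payoff profiles at the $2^n$ leaves are independent and uniformly distributed on $C$ (the first coordinate is the payoff of Player 1, the second that of Player 2). Independently of the payoffs and independently across nodes, each non-leaf node at depth $n-k$ is controlled by Player 1 with probability $\frac12+\varepsilon$ and by Player 2 with probability $\frac12-\varepsilon$ if $k$ is odd, and by Player 2 with probability $\frac12+\varepsilon$ and by Player 1 with probability $\frac12-\varepsilon$ if $k$ is even. Let $\mathsf{Val}(H^\varepsilon_n)$ be the random payoff profile at the (pure) subgame perfect equilibrium of $H^\varepsilon_n$. The values $\mathsf{Val}(H^\varepsilon_n)$ \emph{concentrate around} a point $c\in\mathbb{R}^2$ as $n\to\infty$ if their distributions converge weakly to the Dirac measure $\delta_c$. Then the following hold. (0) (The solution is well defined.) For every bargaining set $C$, every $0<\varepsilon\le\frac12$ and every $n$, the game $H^\varepsilon_n$ has almost surely a unique subgame perfect equilibrium.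 For every bargaining set $C$ and every $0<\varepsilon\le\frac12$ the values $\mathsf{Val}(H^\varepsilon_n)$ concentrate, as $n\to\infty$, around a (necessarily unique) point $c^\varepsilon(C)$, and the limit $$\mathrm{REF}(C):=\lim_{\varepsilon\to0^+}c^\varepsilon(C)=\lim_{\varepsilon\to 0^+}\lim_{n\to\infty}\mathsf{Val}(H^\varepsilon_n)$$ exists. It is called the \emph{random-extensive-form (REF) solution}. (1) (Pareto efficiency.) For every bargaining set $C$, $\mathrm{REF}(C)\in C$, and no point $w\in C$ other than $\mathrm{REF}(C)$ satisfies $w_1\ge\mathrm{REF}(C)_1$ and $w_2\ge\mathrm{REF}(C)_2$. (2) (Symmetry.) If the bargaining set $C$ is symmetric, that is, $\{(y,x):(x,y)\in C\}=C$, then $\mathrm{REF}(C)_1=\mathrm{REF}(C)_2$. (3) (Invariance under positive affine transformations.) For every bargaining set $C$ and all real $a_1,a_2>0$ and $b_1,b_2$, with $T(x,y)=(a_1x+b_1,\,a_2y+b_2)$, one has $\mathrm{REF}(T(C))=T(\mathrm{REF}(C))$. -/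

import Mathlib

open MeasureTheory Filter Topology

noncomputable section

namespace RandomGame

/-- The two players: `0` is Player 1 and `1` is Player 2. -/
abbrev Player : Type := Fin 2

/-- The payoff of player `i` in the payoff profile `u`. -/
def payoff (i : Player) (u : ℝ × ℝ) : ℝ := if i = 0 then u.1 else u.2

/-- An extensive form game with perfect information over the complete binary tree of depth `n`:
in depth `0` there is only a leaf with its payoff profile; in depth `n + 1` there is the player
who controls the root, the left subgame and the right subgame, both of depth `n`. -/
def Game : ℕ → Type
  | 0 => ℝ × ℝ
  | n + 1 => Player × Game n × Game n

/-- The product sigma-algebra on games (all players at the nodes, all payoffs at the leaves). -/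
instance Game.instMeasurableSpace : (n : ℕ) → MeasurableSpace (Game n)
  | 0 => inferInstanceAs (MeasurableSpace (ℝ × ℝ))
  | n + 1 =>
    letI := Game.instMeasurableSpace n
    inferInstanceAs (MeasurableSpace (Player × Game n × Game n))

/-- A pure strategy profile: a choice at every node (`false` is left, `true` is right). The
strategy of player `i` is its restriction to the nodes that `i` controls. -/
def Strategy : ℕ → Type
  | 0 => Unit
  | n + 1 => Bool × Strategy n × Strategy n

/-- The payoff profile at the leaf that is reached under a strategy profile. -/
def outcome : {n : ℕ} → Game n → Strategy n → ℝ × ℝ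
  | 0, u, _ => u
  | _ + 1, (_, l, r), (a, s, t) => bif a then outcome r t else outcome l s

/-- `IsDeviation i G σ τ`: the profile `τ` arises from `σ` by a deviation of player `i`, that is,
both make the same choice at every node that `i` does not control. -/
def IsDeviation (i : Player) : {n : ℕ} → Game n → Strategy n → Strategy n → Prop
  | 0, _, _, _ => True
  | _ + 1, (j, l, r), (a, s, t), (a₂, s₂, t₂) =>
    (j ≠ i → a₂ = a) ∧ IsDeviation i l s s₂ ∧ IsDeviation i r t t₂

/-- Nash equilibrium: no player gains by a unilateral deviation. -/
def IsNash {n : ℕ} (G : Game n) (σ : Strategy n) : Prop :=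
  ∀ (i : Player) (τ : Strategy n), IsDeviation i G σ τ →
    payoff i (outcome G τ) ≤ payoff i (outcome G σ)

/-- Subgame perfect equilibrium: a Nash equilibrium in the game and in each of its subgames. -/
def IsSPE : {n : ℕ} → Game n → Strategy n → Prop
  | 0, G, σ => IsNash (n := 0) G σ
  | n + 1, (j, l, r), (a, s, t) =>
    IsNash (n := n + 1) (j, l, r) (a, s, t) ∧ IsSPE l s ∧ IsSPE r t

instance Strategy.instNonempty : (n : ℕ) → Nonempty (Strategy n)
  | 0 => ⟨()⟩
  | n + 1 => (Strategy.instNonempty n).elim fun s => ⟨(false, s, s)⟩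

/-- The value of a game: the payoff profile at its subgame perfect equilibrium. (If there are
several, one of them is chosen; in the random games below there is almost surely only one.) -/
def value {n : ℕ} (G : Game n) : ℝ × ℝ := outcome G (Classical.epsilon (IsSPE G))

/-- The distribution of the player who controls a node at depth `n - k` of the hybrid game of
depth `n`: for odd `k` it is Player 1 with probability `1/2 + ε` and Player 2 with probability
`1/2 - ε`; for even `k` the two are exchanged. -/
def controllerLaw (ε : ℝ) (k : ℕ) : Measure Player :=
  if Odd k then
    ENNReal.ofReal (1 / 2 + ε) • Measure.dirac 0 + ENNReal.ofReal (1 / 2 - ε) • Measure.dirac 1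
  else
    ENNReal.ofReal (1 / 2 - ε) • Measure.dirac 0 + ENNReal.ofReal (1 / 2 + ε) • Measure.dirac 1

/-- The distribution of the random hybrid game of depth `n`: the payoffs at the leaves are
uniform on `C`, the players at the nodes are distributed by `controllerLaw`, and all these are
independent. -/
def hybridGame (C : Set (ℝ × ℝ)) (ε : ℝ) : (n : ℕ) → Measure (Game n)
  | 0 => (ProbabilityTheory.cond volume C : Measure (ℝ × ℝ))
  | n + 1 => (Measure.prod (controllerLaw ε (n + 1))
      (Measure.prod (hybridGame C ε n) (hybridGame C ε n)) : Measure (Player × Game n × Game n))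

/-- The distribution of the value of the random hybrid game of depth `n`. -/
def valueLaw (C : Set (ℝ × ℝ)) (ε : ℝ) (n : ℕ) : Measure (ℝ × ℝ) :=
  (hybridGame C ε n).map value

/-- The sequence `μ` consists of probability measures and converges weakly to the Dirac measure
at `c`. -/
def ConcentratesAround (μ : ℕ → Measure (ℝ × ℝ)) (c : ℝ × ℝ) : Prop :=
  ∃ ν : ℕ → ProbabilityMeasure (ℝ × ℝ),
    (∀ n, (ν n : Measure (ℝ × ℝ)) = μ n) ∧ Tendsto ν atTop (𝓝 (diracProba c))

/-- A bargaining set (feasible set): compact, convex, with non-empty interior. -/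
structure IsBargainingSet (C : Set (ℝ × ℝ)) : Prop where
  isCompact : IsCompact C
  convex : Convex ℝ C
  nonempty_interior : (interior C).Nonempty

/-- `z` is the limit for `ε → 0`, `ε > 0`, of the points around which the values of the hybrid
games with parameter `ε` concentrate as the depth tends to infinity. -/
def IsREFSolution (C : Set (ℝ × ℝ)) (z : ℝ × ℝ) : Prop :=
  ∃ c : ℝ → ℝ × ℝ,
    (∀ ε ∈ Set.Ioc (0 : ℝ) (1 / 2), ConcentratesAround (valueLaw C ε) (c ε)) ∧
      Tendsto c (𝓝[>] 0) (𝓝 z)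

/-- The random-extensive-form solution. -/
def refSolution (C : Set (ℝ × ℝ)) : ℝ × ℝ := Classical.epsilon (IsREFSolution C)

/-- `z` is a feasible point, and no other feasible point is at least as good for both players. -/
def IsParetoEfficient (C : Set (ℝ × ℝ)) (z : ℝ × ℝ) : Prop :=
  z ∈ C ∧ ∀ w ∈ C, z.1 ≤ w.1 → z.2 ≤ w.2 → w = z

/-- A solution `φ` of the bargaining problem (only its values at bargaining sets matter) is
standard if it is Pareto efficient, symmetric, and invariant under positive affine
transformations of the payoffs of the two players. -/
structure IsStandardSolution (φ : Set (ℝ × ℝ) → ℝ × ℝ) : Prop where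
  paretoEfficient : ∀ C, IsBargainingSet C → IsParetoEfficient C (φ C)
  symmetric : ∀ C, IsBargainingSet C → Prod.swap '' C = C → (φ C).1 = (φ C).2
  affineInvariant : ∀ C, IsBargainingSet C → ∀ a₁ a₂ b₁ b₂ : ℝ, 0 < a₁ → 0 < a₂ →
    φ ((fun u : ℝ × ℝ => (a₁ * u.1 + b₁, a₂ * u.2 + b₂)) '' C) =
      (a₁ * (φ C).1 + b₁, a₂ * (φ C).2 + b₂)

end RandomGame

end

/-!
The argument follows the distribution `μ` of the value of the hybrid game from depth to depth. By
backward induction (`valueLaw_eq`) the distribution at depth `n + 1` is that of a choice between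
two independent samples of the distribution at depth `n`; Player 1 makes this choice with
probability `(1 + b) / 2`, where `b = bias e n` alternates between `e = 2 ε` and `-e`. The value
`e = 0`, at which nothing concentrates, and negative values, which arise when the players are
exchanged, are admitted throughout.

*Thresholds.* Let `r` be the probability that Player 1 receives more than `x`. Player 1 chooses a
payoff above `x` whenever there is one, and Player 2 has to choose one if both are above `x`; hence
in one round `r` becomes at least `r + b r (1 - r)` (`tailX_succ_ge`). If `e ≠ 0`, then two rounds
form a bistable system: once `r` is above the unstable fixed point, that is, once
`excess b r = 2 r - 1 + b r (1 - r)` is positive, `r` tends to `1` (`tendsto_tailX_one`). So there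
is a threshold `critX` such that Player 1 almost certainly gets more than each `x` below it, whereas
the tail at each `x` above it never exceeds the fixed point. Likewise there is a threshold
`critY` for Player 2, whose fixed points are complementary to those of Player 1. It remains to show
that `critSet`, the set of feasible points with both coordinates at or above the thresholds, is a
single point.

*No point strictly above both thresholds* (`not_crit_lt`). The distribution after a round has an
explicit density with respect to the one before. Above both thresholds the bounds on the tails make
this density at least `1`, so that a small box there keeps its mass; this improves the bounds on the
tails beyond the box, where the density is then at least some constant above `1`, and the mass
would grow exponentially.

*No edge* (`snd_le_critY`). Otherwise `critSet` is a piece of a vertical or, symmetrically, a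
horizontal edge of `C`. All densities are monotone in the payoffs, so that moving a set upwards
inside `C` increases its mass (`map_add_restrict_law_le`). If `e ≠ 0`, the payoff of Player 2 keeps
a fixed amount of mass arbitrarily close to `critY`; a thin slab there has many disjoint translates
of at least the same mass, which is absurd. If `e = 0`, then the tails are nondecreasing, and the
strip along the edge provides in every round a fixed amount of pairs about which the players agree;
these would increase a tail without bound.

*The limit.* For `e ≠ 0` the values thus concentrate around the point of `critSet C e`. For fixed
depth, the distributions for small `e` are bounded below by almost the one for `e = 0`
(`smul_law_zero_le`), so that the thresholds are lower semicontinuous at `e = 0`, and by compactness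
the points converge to the only point of `critSet C 0`. Pareto efficiency and symmetry are read off
from this description, and affine invariance follows from that of the recursion.
-/

noncomputable section

namespace RandomGame

/-! ### Backward induction -/

/-- The better of two payoff profiles for player `i`; the first one if they are equally good. -/
def pick (i : Player) (w : (ℝ × ℝ) × (ℝ × ℝ)) : ℝ × ℝ :=
  if payoff i w.1 < payoff i w.2 then w.2 else w.1

/-- The payoff profile found by backward induction. -/
def backwardValue : {n : ℕ} → Game n → ℝ × ℝ
  | 0, u => u
  | _ + 1, (j, l, r) => pick j (backwardValue l, backwardValue r)

/-- No player is ever indifferent between the two backward induction values at a node which that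
player controls. -/
def IsGeneric : {n : ℕ} → Game n → Prop
  | 0, _ => True
  | _ + 1, (j, l, r) =>
    payoff j (backwardValue l) ≠ payoff j (backwardValue r) ∧ IsGeneric l ∧ IsGeneric r

/-- The strategy profile found by backward induction. -/
def backwardStrategy : {n : ℕ} → Game n → Strategy n
  | 0, _ => ()
  | _ + 1, (j, l, r) =>
    (decide (payoff j (backwardValue l) < payoff j (backwardValue r)),
      backwardStrategy l, backwardStrategy r)

lemma outcome_backwardStrategy : ∀ {n : ℕ} (G : Game n),
    outcome G (backwardStrategy G) = backwardValue G
  | 0, _ => rfl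
  | n + 1, (j, l, r) => by
    change (bif decide (payoff j (backwardValue l) < payoff j (backwardValue r))
      then outcome r (backwardStrategy r) else outcome l (backwardStrategy l)) =
      pick j (backwardValue l, backwardValue r)
    rw [outcome_backwardStrategy l, outcome_backwardStrategy r]
    by_cases h : payoff j (backwardValue l) < payoff j (backwardValue r) <;> simp [pick, h]

lemma isDeviation_refl (i : Player) : ∀ {n : ℕ} (G : Game n) (σ : Strategy n),
    IsDeviation i G σ σ
  | 0, _, _ => trivial
  | _ + 1, (_, l, r), (_, s, t) => ⟨fun _ => rfl, isDeviation_refl i l s, isDeviation_refl i r t⟩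

/-- A deviation gains nothing in either subgame, and at the root only a player who already chooses
the better subgame can deviate. -/
lemma isNash_backwardStrategy : ∀ {n : ℕ} (G : Game n), IsNash G (backwardStrategy G)
  | 0, G => fun _ _ _ => le_rfl
  | n + 1, (j, l, r) => by
    rintro i ⟨a, s, t⟩ ⟨ha, hs, ht⟩
    have h1 := isNash_backwardStrategy l i s hs
    have h2 := isNash_backwardStrategy r i t ht
    rw [outcome_backwardStrategy] at h1 h2
    refine le_of_le_of_eq ?_ (congrArg (payoff i)
      (outcome_backwardStrategy (n := n + 1) (j, l, r)).symm)
    change payoff i (bif a then outcome r t else outcome l s) ≤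
      payoff i (pick j (backwardValue l, backwardValue r))
    by_cases hj : j = i
    · subst hj
      unfold pick
      cases a <;> split_ifs with h <;> simp only [cond_true, cond_false] at h ⊢ <;> linarith
    · rw [ha hj]
      by_cases h : payoff j (backwardValue l) < payoff j (backwardValue r) <;>
        simp [pick, h, h1, h2]

lemma isSPE_backwardStrategy : ∀ {n : ℕ} (G : Game n), IsSPE G (backwardStrategy G)
  | 0, G => isNash_backwardStrategy (n := 0) G
  | n + 1, (j, l, r) =>
    ⟨isNash_backwardStrategy (n := n + 1) (j, l, r), isSPE_backwardStrategy l,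
      isSPE_backwardStrategy r⟩

lemma IsGeneric.eq_backwardStrategy : ∀ {n : ℕ} {G : Game n}, IsGeneric G →
    ∀ {σ : Strategy n}, IsSPE G σ → σ = backwardStrategy G
  | 0, _, _, _, _ => rfl
  | n + 1, (j, l, r), ⟨hne, hl, hr⟩, (a, s, t), ⟨hN, hs, ht⟩ => by
    obtain rfl := hl.eq_backwardStrategy hs
    obtain rfl := hr.eq_backwardStrategy ht
    have := hN j (!a, backwardStrategy l, backwardStrategy r)
      ⟨fun h => absurd rfl h, isDeviation_refl _ _ _, isDeviation_refl _ _ _⟩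
    change payoff j (bif !a then outcome r (backwardStrategy r) else
      outcome l (backwardStrategy l)) ≤ payoff j (bif a then outcome r (backwardStrategy r) else
      outcome l (backwardStrategy l)) at this
    simp only [outcome_backwardStrategy] at this
    change (a, _, _) = (decide _, _, _)
    congr 1
    cases a
    · simpa using this
    · simpa using lt_of_le_of_ne this hne

lemma IsGeneric.existsUnique_isSPE {n : ℕ} {G : Game n} (hG : IsGeneric G) :
    ∃! σ, IsSPE G σ :=
  ⟨backwardStrategy G, isSPE_backwardStrategy G, fun _ h => hG.eq_backwardStrategy h⟩

lemma IsGeneric.value_eq {n : ℕ} {G : Game n} (hG : IsGeneric G) : value G = backwardValue G := by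
  unfold value
  rw [hG.eq_backwardStrategy (Classical.epsilon_spec ⟨_, isSPE_backwardStrategy G⟩),
    outcome_backwardStrategy]

/-! ### One round of the recursion for the distribution of the value -/

@[fun_prop]
lemma measurable_payoff (i : Player) : Measurable (payoff i) := by
  unfold payoff; split_ifs <;> fun_prop

@[fun_prop]
lemma measurable_pick (i : Player) : Measurable (pick i) := by
  unfold pick
  refine Measurable.ite (measurableSet_lt ?_ ?_) ?_ ?_ <;> fun_prop

/-- The distribution of the choice from two independent samples of `μ`, made by Player 1 with
probability `p` and by Player 2 with probability `1 - p`. -/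
def step (p : ℝ) (μ : Measure (ℝ × ℝ)) : Measure (ℝ × ℝ) :=
  ENNReal.ofReal p • (μ.prod μ).map (pick 0) + ENNReal.ofReal (1 - p) • (μ.prod μ).map (pick 1)

lemma isProbabilityMeasure_step {p : ℝ} (h0 : 0 ≤ p) (h1 : p ≤ 1) (μ : Measure (ℝ × ℝ))
    [IsProbabilityMeasure μ] : IsProbabilityMeasure (step p μ) := by
  have h (i) : IsProbabilityMeasure ((μ.prod μ).map (pick i)) :=
    Measure.isProbabilityMeasure_map (measurable_pick i).aemeasurable
  constructor
  simp [step, ← ENNReal.ofReal_add h0 (sub_nonneg.2 h1)]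

lemma step_real {p : ℝ} (h0 : 0 ≤ p) (h1 : p ≤ 1) (μ : Measure (ℝ × ℝ)) [IsProbabilityMeasure μ]
    {A : Set (ℝ × ℝ)} (hA : MeasurableSet A) :
    (step p μ).real A = p * (μ.prod μ).real (pick 0 ⁻¹' A) +
      (1 - p) * (μ.prod μ).real (pick 1 ⁻¹' A) := by
  have h (i) : IsProbabilityMeasure ((μ.prod μ).map (pick i)) :=
    Measure.isProbabilityMeasure_map (measurable_pick i).aemeasurable
  unfold step
  rw [measureReal_add_apply (ENNReal.mul_ne_top ENNReal.ofReal_ne_top (measure_ne_top _ _))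
    (ENNReal.mul_ne_top ENNReal.ofReal_ne_top (measure_ne_top _ _)),
    measureReal_ennreal_smul_apply, measureReal_ennreal_smul_apply,
    ENNReal.toReal_ofReal h0, ENNReal.toReal_ofReal (sub_nonneg.2 h1),
    map_measureReal_apply (measurable_pick 0) hA, map_measureReal_apply (measurable_pick 1) hA]

lemma step_absolutelyContinuous (p : ℝ) (μ : Measure (ℝ × ℝ)) [SFinite μ] : step p μ ≪ μ := by
  intro A hA
  obtain ⟨B, hAB, hB, hμ⟩ := exists_measurable_superset_of_null hA
  refine measure_mono_null hAB ?_
  have h (i : Player) : ((μ.prod μ).map (pick i)) B = 0 := by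
    rw [Measure.map_apply (measurable_pick i) hB]
    refine measure_mono_null (t := B ×ˢ Set.univ ∪ Set.univ ×ˢ B) ?_ ?_
    · intro w hw
      simp only [pick, Set.mem_preimage] at hw
      split_ifs at hw <;> simp [hw]
    · simp [hμ]
  simp [step, h]

lemma map_step (p : ℝ) (μ : Measure (ℝ × ℝ)) [SFinite μ] {f : ℝ × ℝ → ℝ × ℝ}
    (hf : Measurable f) (h : ∀ i w, f (pick i w) = pick i (Prod.map f f w)) :
    (step p μ).map f = step p (μ.map f) := by
  unfold step
  rw [Measure.map_add _ _ hf, Measure.map_smul, Measure.map_smul, Measure.map_prod_map _ _ hf hf]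
  simp_rw [Measure.map_map hf (measurable_pick _),
    Measure.map_map (measurable_pick _) (hf.prodMap hf)]
  have (i : Player) : f ∘ pick i = pick i ∘ Prod.map f f := funext (h i)
  rw [this, this]

lemma map_swap_step (p : ℝ) (μ : Measure (ℝ × ℝ)) [SFinite μ] :
    (step p μ).map Prod.swap = step (1 - p) (μ.map Prod.swap) := by
  unfold step
  rw [Measure.map_add _ _ measurable_swap, Measure.map_smul, Measure.map_smul,
    Measure.map_prod_map _ _ measurable_swap measurable_swap]
  simp_rw [Measure.map_map measurable_swap (measurable_pick _),
    Measure.map_map (measurable_pick _) (measurable_swap.prodMap measurable_swap)]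
  have h0 : Prod.swap ∘ pick 0 = pick 1 ∘ Prod.map Prod.swap Prod.swap := by
    ext w <;> simp [pick, payoff] <;> split_ifs <;> rfl
  have h1 : Prod.swap ∘ pick 1 = pick 0 ∘ Prod.map Prod.swap Prod.swap := by
    ext w <;> simp [pick, payoff] <;> split_ifs <;> rfl
  rw [h0, h1, sub_sub_cancel, add_comm]

/-- The choice of player `i` from two samples of `μ` has a density with respect to `μ`: a sample
is chosen if the other one is worse for player `i`. -/
lemma map_pick_prod (i : Player) (μ : Measure (ℝ × ℝ)) [SFinite μ] :
    (μ.prod μ).map (pick i) = μ.withDensity fun u =>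
      μ {v | payoff i v ≤ payoff i u} + μ {v | payoff i v < payoff i u} := by
  ext A hA
  have hlt : MeasurableSet {w : (ℝ × ℝ) × (ℝ × ℝ) | payoff i w.1 < payoff i w.2} :=
    measurableSet_lt (by fun_prop) (by fun_prop)
  have hle : MeasurableSet {w : (ℝ × ℝ) × (ℝ × ℝ) | payoff i w.2 ≤ payoff i w.1} :=
    measurableSet_le (by fun_prop) (by fun_prop)
  have hm1 : MeasurableSet ({w : (ℝ × ℝ) × (ℝ × ℝ) | payoff i w.2 ≤ payoff i w.1} ∩
      Prod.fst ⁻¹' A) := hle.inter (measurable_fst hA)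
  have hm2 : MeasurableSet ({w : (ℝ × ℝ) × (ℝ × ℝ) | payoff i w.1 < payoff i w.2} ∩
      Prod.snd ⁻¹' A) := hlt.inter (measurable_snd hA)
  have hd1 : Measurable fun u => μ {v | payoff i v ≤ payoff i u} :=
    measurable_measure_prodMk_left hle
  rw [Measure.map_apply (measurable_pick i) hA, withDensity_apply _ hA, lintegral_add_left hd1]
  have : pick i ⁻¹' A = ({w | payoff i w.2 ≤ payoff i w.1} ∩ Prod.fst ⁻¹' A) ∪
      ({w | payoff i w.1 < payoff i w.2} ∩ Prod.snd ⁻¹' A) := by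
    ext w
    by_cases h : payoff i w.1 < payoff i w.2
    · simp [pick, h]
    · simp [pick, h, not_lt.1 h]
  rw [this, measure_union ?_ hm2, Measure.prod_apply hm1, Measure.prod_apply_symm hm2]
  · congr 1
    · rw [← lintegral_indicator hA]
      congr 1 with u
      by_cases hu : u ∈ A
      · rw [Set.indicator_of_mem hu]
        congr 1
        ext v
        simp [hu]
      · rw [Set.indicator_of_notMem hu]
        convert measure_empty (μ := μ)
        ext v
        simp [hu]
    · rw [← lintegral_indicator hA]
      congr 1 with u
      by_cases hu : u ∈ A
      · rw [Set.indicator_of_mem hu]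
        congr 1
        ext v
        simp [hu]
      · rw [Set.indicator_of_notMem hu]
        convert measure_empty (μ := μ)
        ext v
        simp [hu]
  · rw [Set.disjoint_left]
    rintro w ⟨h, -⟩ ⟨h', -⟩
    exact not_lt.2 (show payoff i w.2 ≤ payoff i w.1 from h) h'

/-- The density of `step p μ` with respect to `μ`. -/
def stepDensity (p : ℝ) (μ : Measure (ℝ × ℝ)) (u : ℝ × ℝ) : ENNReal :=
  ENNReal.ofReal p * (μ {v | v.1 ≤ u.1} + μ {v | v.1 < u.1}) +
    ENNReal.ofReal (1 - p) * (μ {v | v.2 ≤ u.2} + μ {v | v.2 < u.2})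

lemma monotone_stepDensity (p : ℝ) (μ : Measure (ℝ × ℝ)) : Monotone (stepDensity p μ) := by
  intro u w h
  unfold stepDensity
  have h1 := h.1
  have h2 := h.2
  gcongr

lemma step_eq_withDensity (p : ℝ) (μ : Measure (ℝ × ℝ)) [SFinite μ] :
    step p μ = μ.withDensity (stepDensity p μ) := by
  have h1 : Measurable fun u : ℝ × ℝ => μ {v | v.1 ≤ u.1} + μ {v | v.1 < u.1} :=
    (measurable_measure_prodMk_left (s := {w : (ℝ × ℝ) × (ℝ × ℝ) | w.2.1 ≤ w.1.1})
      (measurableSet_le (by fun_prop) (by fun_prop))).add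
    (measurable_measure_prodMk_left (s := {w : (ℝ × ℝ) × (ℝ × ℝ) | w.2.1 < w.1.1})
      (measurableSet_lt (by fun_prop) (by fun_prop)))
  unfold step
  rw [map_pick_prod, map_pick_prod, ← withDensity_smul' _ _ ENNReal.ofReal_ne_top,
    ← withDensity_smul' _ _ ENNReal.ofReal_ne_top,
    ← withDensity_add_left (by simpa [payoff] using h1.const_smul _)]
  rfl

lemma measurable_stepDensity (p : ℝ) (μ : Measure (ℝ × ℝ)) [SFinite μ] :
    Measurable (stepDensity p μ) := by
  have h1 : Measurable fun u : ℝ × ℝ => μ {v | v.1 ≤ u.1} + μ {v | v.1 < u.1} :=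
    (measurable_measure_prodMk_left (s := {w : (ℝ × ℝ) × (ℝ × ℝ) | w.2.1 ≤ w.1.1})
      (measurableSet_le (by fun_prop) (by fun_prop))).add
    (measurable_measure_prodMk_left (s := {w : (ℝ × ℝ) × (ℝ × ℝ) | w.2.1 < w.1.1})
      (measurableSet_lt (by fun_prop) (by fun_prop)))
  have h2 : Measurable fun u : ℝ × ℝ => μ {v | v.2 ≤ u.2} + μ {v | v.2 < u.2} :=
    (measurable_measure_prodMk_left (s := {w : (ℝ × ℝ) × (ℝ × ℝ) | w.2.2 ≤ w.1.2})
      (measurableSet_le (by fun_prop) (by fun_prop))).add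
    (measurable_measure_prodMk_left (s := {w : (ℝ × ℝ) × (ℝ × ℝ) | w.2.2 < w.1.2})
      (measurableSet_lt (by fun_prop) (by fun_prop)))
  exact (h1.const_mul _).add (h2.const_mul _)

/-- Each player moves with probability at least `(1 - e) / 2`, which is `1 - e` times the
probability under fair control. -/
lemma step_mono_smul {p e : ℝ} {c : ENNReal} {μ ν : Measure (ℝ × ℝ)} [SFinite μ] [SFinite ν]
    (hp : 1 - e ≤ 2 * p) (hp' : 2 * p ≤ 1 + e) (h : c • ν ≤ μ) :
    (ENNReal.ofReal (1 - e) * c ^ 2) • step (1 / 2) ν ≤ step p μ := by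
  have hprod : c ^ 2 • ν.prod ν ≤ μ.prod μ := by
    calc c ^ 2 • ν.prod ν = (c • ν).prod (c • ν) := by
          rw [Measure.prod_smul_left, Measure.prod_smul_right, smul_smul, sq]
      _ ≤ μ.prod μ := Measure.prod_mono h h
  have hpick (i : Player) : c ^ 2 • (ν.prod ν).map (pick i) ≤ (μ.prod μ).map (pick i) := by
    rw [← Measure.map_smul]
    exact Measure.map_mono hprod (measurable_pick i)
  have key (q : ℝ) (i : Player) (hq : 1 - e ≤ 2 * q) :
      (ENNReal.ofReal (1 - e) * c ^ 2) • ENNReal.ofReal (1 / 2) • (ν.prod ν).map (pick i) ≤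
        ENNReal.ofReal q • (μ.prod μ).map (pick i) := by
    rw [smul_smul, mul_assoc, mul_comm (c ^ 2), ← mul_assoc, ← smul_smul,
      ← ENNReal.ofReal_mul' (by norm_num)]
    have : ENNReal.ofReal ((1 - e) * (1 / 2)) ≤ ENNReal.ofReal q :=
      ENNReal.ofReal_le_ofReal (by linarith)
    intro A
    simp only [Measure.smul_apply, smul_eq_mul]
    exact mul_le_mul' this (hpick i A)
  unfold step
  rw [smul_add, show (1 : ℝ) - 1 / 2 = 1 / 2 by norm_num]
  exact add_le_add (key p 0 hp) (key (1 - p) 1 (by linarith))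

/-! ### The distribution of the value of the hybrid game -/

/-- The advantage `e * (-1) ^ n` of Player 1 in the round that leads from depth `n` to depth
`n + 1`: in this round Player 1 moves with probability `(1 + bias e n) / 2`. -/
def bias (e : ℝ) (n : ℕ) : ℝ := e * (-1) ^ n

/-- The distribution of the value of the hybrid game with parameter `ε = e / 2`. The sign of `e` is
arbitrary, so that exchanging the players amounts to replacing `e` by `-e`; for `e = 0` each node
is controlled by a player chosen by a fair coin. -/
def law (C : Set (ℝ × ℝ)) (e : ℝ) : ℕ → Measure (ℝ × ℝ)
  | 0 => ProbabilityTheory.cond volume C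
  | n + 1 => step ((1 + bias e n) / 2) (law C e n)

lemma bias_zero (n : ℕ) : bias 0 n = 0 := by simp [bias]

lemma bias_neg (e : ℝ) (n : ℕ) : bias (-e) n = -bias e n := by simp [bias]

lemma bias_succ (e : ℝ) (n : ℕ) : bias e (n + 1) = -bias e n := by simp [bias, pow_succ]

lemma bias_sq (e : ℝ) (n : ℕ) : bias e n ^ 2 = e ^ 2 := by
  simp [bias, mul_pow, ← pow_mul, mul_comm n 2]

lemma abs_bias (e : ℝ) (n : ℕ) : |bias e n| = |e| := by simp [bias, abs_mul]

variable {C : Set (ℝ × ℝ)} {e : ℝ}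

lemma IsBargainingSet.measurableSet (hC : IsBargainingSet C) : MeasurableSet C :=
  hC.isCompact.measurableSet

lemma IsBargainingSet.volume_ne_zero (hC : IsBargainingSet C) : volume C ≠ 0 :=
  (Measure.measure_pos_of_nonempty_interior _ hC.nonempty_interior).ne'

lemma IsBargainingSet.isProbabilityMeasure_cond (hC : IsBargainingSet C) :
    IsProbabilityMeasure (ProbabilityTheory.cond volume C) :=
  ProbabilityTheory.cond_isProbabilityMeasure_of_finite hC.volume_ne_zero
    hC.isCompact.measure_lt_top.ne

lemma isProbabilityMeasure_law (hC : IsBargainingSet C) (he : |e| ≤ 1) (n : ℕ) :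
    IsProbabilityMeasure (law C e n) := by
  induction n with
  | zero => exact hC.isProbabilityMeasure_cond
  | succ n ih =>
    have := abs_le.1 ((abs_bias e n).trans_le he)
    exact isProbabilityMeasure_step (by linarith) (by linarith) _

lemma law_absolutelyContinuous_cond (hC : IsBargainingSet C) (he : |e| ≤ 1) (n : ℕ) :
    law C e n ≪ ProbabilityTheory.cond volume C := by
  induction n with
  | zero => exact Measure.AbsolutelyContinuous.rfl
  | succ n ih =>
    have := isProbabilityMeasure_law hC he n
    exact (step_absolutelyContinuous _ _).trans ih

lemma law_absolutelyContinuous (hC : IsBargainingSet C) (he : |e| ≤ 1) (n : ℕ) :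
    law C e n ≪ volume :=
  (law_absolutelyContinuous_cond hC he n).trans ProbabilityTheory.cond_absolutelyContinuous

lemma law_compl (hC : IsBargainingSet C) (he : |e| ≤ 1) (n : ℕ) : law C e n Cᶜ = 0 := by
  refine law_absolutelyContinuous_cond hC he n ?_
  rw [ProbabilityTheory.cond_apply hC.measurableSet]
  simp

lemma ae_mem_law (hC : IsBargainingSet C) (he : |e| ≤ 1) (n : ℕ) : ∀ᵐ u ∂law C e n, u ∈ C :=
  law_compl hC he n

lemma abs_two_mul_le {ε : ℝ} (hε : ε ∈ Set.Ioc (0 : ℝ) (1 / 2)) : |2 * ε| ≤ 1 := by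
  rw [abs_le]; constructor <;> linarith [hε.1, hε.2]

lemma measurable_backwardValue : ∀ n : ℕ, Measurable (backwardValue : Game n → ℝ × ℝ)
  | 0 => measurable_id (α := ℝ × ℝ)
  | n + 1 => by
    have ih := measurable_backwardValue n
    have key : Measurable fun w : Player × Game n × Game n =>
        pick w.1 (backwardValue w.2.1, backwardValue w.2.2) :=
      measurable_from_prod_countable_right fun j => (measurable_pick j).comp
        ((ih.comp measurable_fst).prodMk (ih.comp measurable_snd))
    exact key

lemma controllerLaw_eq (ε : ℝ) (n : ℕ) : controllerLaw ε (n + 1) =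
    ENNReal.ofReal ((1 + bias (2 * ε) n) / 2) • Measure.dirac 0 +
      ENNReal.ofReal (1 - (1 + bias (2 * ε) n) / 2) • Measure.dirac 1 := by
  unfold controllerLaw bias
  rcases Nat.even_or_odd n with h | h
  · rw [if_pos h.add_one, h.neg_one_pow]
    ring_nf
  · rw [if_neg (by simpa using h.add_one), h.neg_one_pow]
    ring_nf

lemma isProbabilityMeasure_controllerLaw {ε : ℝ} (hε : ε ∈ Set.Ioc (0 : ℝ) (1 / 2)) (n : ℕ) :
    IsProbabilityMeasure (controllerLaw ε (n + 1)) := by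
  have := abs_le.1 ((abs_bias (2 * ε) n).trans_le (abs_two_mul_le hε))
  rw [controllerLaw_eq]
  constructor
  simp only [Measure.add_apply, Measure.smul_apply, measure_univ, smul_eq_mul, mul_one]
  rw [← ENNReal.ofReal_add (by linarith) (by linarith)]
  simp

lemma isProbabilityMeasure_hybridGame (hC : IsBargainingSet C) {ε : ℝ}
    (hε : ε ∈ Set.Ioc (0 : ℝ) (1 / 2)) : ∀ n, IsProbabilityMeasure (hybridGame C ε n)
  | 0 => hC.isProbabilityMeasure_cond
  | n + 1 => by
    have := isProbabilityMeasure_controllerLaw hε n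
    have := isProbabilityMeasure_hybridGame hC hε n
    exact inferInstanceAs (IsProbabilityMeasure ((controllerLaw ε (n + 1)).prod
      ((hybridGame C ε n).prod (hybridGame C ε n))))

lemma map_backwardValue (hC : IsBargainingSet C) {ε : ℝ} (hε : ε ∈ Set.Ioc (0 : ℝ) (1 / 2)) :
    ∀ n, (hybridGame C ε n).map backwardValue = law C (2 * ε) n
  | 0 => Measure.map_id (μ := ProbabilityTheory.cond (volume : Measure (ℝ × ℝ)) C)
  | n + 1 => by
    have := isProbabilityMeasure_hybridGame hC hε n
    have := isProbabilityMeasure_controllerLaw hε n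
    have ih := map_backwardValue hC hε n
    have hm := measurable_backwardValue n
    change ((controllerLaw ε (n + 1)).prod ((hybridGame C ε n).prod (hybridGame C ε n))).map
      (fun w : Player × Game n × Game n => pick w.1 (backwardValue w.2.1, backwardValue w.2.2)) =
      step _ (law C (2 * ε) n)
    have hM : Measurable fun w : Player × Game n × Game n =>
        pick w.1 (backwardValue w.2.1, backwardValue w.2.2) := measurable_backwardValue (n + 1)
    have hi (i : Player) : ((Measure.dirac i).prod ((hybridGame C ε n).prod (hybridGame C ε n))).map
        (fun w : Player × Game n × Game n => pick w.1 (backwardValue w.2.1, backwardValue w.2.2)) =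
        ((law C (2 * ε) n).prod (law C (2 * ε) n)).map (pick i) := by
      rw [Measure.dirac_prod, Measure.map_map hM measurable_prodMk_left, ← ih,
        Measure.map_prod_map _ _ hm hm, Measure.map_map (measurable_pick i) (hm.prodMap hm)]
      rfl
    rw [controllerLaw_eq, Measure.add_prod, Measure.map_add _ _ hM, Measure.prod_smul_left,
      Measure.prod_smul_left, Measure.map_smul, Measure.map_smul, hi, hi]
    rfl

/-- Two independent samples of an absolutely continuous distribution almost surely differ in both
coordinates. -/
lemma ae_payoff_ne {μ : Measure (ℝ × ℝ)} [SFinite μ] (h : μ ≪ volume) (i : Player) :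
    ∀ᵐ w ∂μ.prod μ, payoff i w.1 ≠ payoff i w.2 := by
  have hm : MeasurableSet {w : (ℝ × ℝ) × (ℝ × ℝ) | payoff i w.1 ≠ payoff i w.2} :=
    (measurableSet_eq_fun (by fun_prop) (by fun_prop)).compl
  rw [Measure.ae_prod_iff_ae_ae hm]
  refine ae_of_all _ fun u => h ?_
  have hfib (a : ℝ) : (volume : Measure (ℝ × ℝ)) {v | a = payoff i v} = 0 := by
    by_cases hi : i = 0
    · have : {v : ℝ × ℝ | a = payoff i v} = {a} ×ˢ Set.univ := by
        ext v; simp [payoff, hi, eq_comm]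
      rw [this, Measure.volume_eq_prod, Measure.prod_prod]; simp
    · have : {v : ℝ × ℝ | a = payoff i v} = Set.univ ×ˢ {a} := by
        ext v; simp [payoff, hi, eq_comm]
      rw [this, Measure.volume_eq_prod, Measure.prod_prod]; simp
  convert hfib (payoff i u) using 2
  ext v
  simp

lemma ae_isGeneric (hC : IsBargainingSet C) {ε : ℝ} (hε : ε ∈ Set.Ioc (0 : ℝ) (1 / 2)) :
    ∀ n, ∀ᵐ G ∂hybridGame C ε n, IsGeneric G
  | 0 => ae_of_all _ fun _ => trivial
  | n + 1 => by
    have := isProbabilityMeasure_hybridGame hC hε n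
    have := isProbabilityMeasure_controllerLaw hε n
    have ih := ae_isGeneric hC hε n
    have hm := measurable_backwardValue n
    have hne (i : Player) : ∀ᵐ w ∂(hybridGame C ε n).prod (hybridGame C ε n),
        payoff i (backwardValue w.1) ≠ payoff i (backwardValue w.2) := by
      have := isProbabilityMeasure_law hC (abs_two_mul_le hε) n
      have h := ae_payoff_ne (law_absolutelyContinuous hC (abs_two_mul_le hε) n) i
      rw [← map_backwardValue hC hε n, Measure.map_prod_map _ _ hm hm] at h
      exact ae_of_ae_map (hm.prodMap hm).aemeasurable h
    have hall : ∀ᵐ w ∂(hybridGame C ε n).prod (hybridGame C ε n),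
        (∀ i, payoff i (backwardValue w.1) ≠ payoff i (backwardValue w.2)) ∧
          IsGeneric w.1 ∧ IsGeneric w.2 :=
      (ae_all_iff.2 hne).and ((Measure.quasiMeasurePreserving_fst.ae ih).and
        (Measure.quasiMeasurePreserving_snd.ae ih))
    have key : ∀ᵐ G ∂(controllerLaw ε (n + 1)).prod ((hybridGame C ε n).prod (hybridGame C ε n)),
        IsGeneric (n := n + 1) G := by
      filter_upwards [Measure.quasiMeasurePreserving_snd.ae hall] with w hw
      exact ⟨hw.1 w.1, hw.2⟩
    exact key

lemma valueLaw_eq (hC : IsBargainingSet C) {ε : ℝ} (hε : ε ∈ Set.Ioc (0 : ℝ) (1 / 2)) (n : ℕ) :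
    valueLaw C ε n = law C (2 * ε) n := by
  rw [← map_backwardValue hC hε]
  exact Measure.map_congr ((ae_isGeneric hC hε n).mono fun _ h => h.value_eq)

/-! ### Change of coordinates -/

/-- Uniform distributions are mapped to uniform distributions by transformations that multiply the
area by a constant. -/
lemma cond_image {k : ENNReal} (hk0 : k ≠ 0) (hk : k ≠ ⊤) (f : ℝ × ℝ ≃ᵐ ℝ × ℝ)
    (hf : Measure.map f volume = k • volume) (C : Set (ℝ × ℝ)) :
    ProbabilityTheory.cond volume (f '' C) = (ProbabilityTheory.cond volume C).map f := by
  have hv : volume C = k * volume (f '' C) := by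
    have := congrArg (fun m => m (f '' C)) hf
    simpa [f.map_apply, Set.preimage_image_eq _ f.injective] using this
  have hr : (volume.restrict C).map f = k • volume.restrict (f '' C) := by
    rw [← Measure.restrict_smul, ← hf, f.restrict_map, Set.preimage_image_eq _ f.injective]
  unfold ProbabilityTheory.cond
  rw [Measure.map_smul, hr, smul_smul, hv, ENNReal.mul_inv (Or.inl hk0) (Or.inl hk), mul_comm k⁻¹,
    mul_assoc, ENNReal.inv_mul_cancel hk0 hk, mul_one]

lemma IsBargainingSet.swap (hC : IsBargainingSet C) : IsBargainingSet (Prod.swap '' C) where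
  isCompact := hC.isCompact.image continuous_swap
  convex := hC.convex.is_linear_image (f := Prod.swap)
    ⟨fun _ _ => rfl, fun _ _ => rfl⟩
  nonempty_interior := by
    have := (Homeomorph.prodComm ℝ ℝ).image_interior C
    rw [Homeomorph.coe_prodComm] at this
    rw [← this]
    exact hC.nonempty_interior.image _

lemma law_swap (hC : IsBargainingSet C) (he : |e| ≤ 1) (n : ℕ) :
    law (Prod.swap '' C) (-e) n = (law C e n).map Prod.swap := by
  induction n with
  | zero =>
    exact cond_image one_ne_zero ENNReal.one_ne_top MeasurableEquiv.prodComm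
      (by rw [one_smul]; exact Measure.measurePreserving_swap.map_eq) C
  | succ n ih =>
    have := isProbabilityMeasure_law hC he n
    change step _ _ = (step _ _).map _
    rw [map_swap_step, ← ih, bias_neg]
    congr 1
    ring

/-- The affine transformation of the payoffs with the given coefficients. -/
def affineHomeomorph {a₁ a₂ : ℝ} (h₁ : a₁ ≠ 0) (h₂ : a₂ ≠ 0) (b₁ b₂ : ℝ) : ℝ × ℝ ≃ₜ ℝ × ℝ :=
  ((Homeomorph.mulLeft₀ a₁ h₁).trans (Homeomorph.addRight b₁)).prodCongr
    ((Homeomorph.mulLeft₀ a₂ h₂).trans (Homeomorph.addRight b₂))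

lemma coe_affineHomeomorph {a₁ a₂ : ℝ} (h₁ : a₁ ≠ 0) (h₂ : a₂ ≠ 0) (b₁ b₂ : ℝ) :
    ⇑(affineHomeomorph h₁ h₂ b₁ b₂) = fun u : ℝ × ℝ => (a₁ * u.1 + b₁, a₂ * u.2 + b₂) := rfl

lemma IsBargainingSet.affine (hC : IsBargainingSet C) {a₁ a₂ : ℝ} (h₁ : a₁ ≠ 0) (h₂ : a₂ ≠ 0)
    (b₁ b₂ : ℝ) :
    IsBargainingSet ((fun u : ℝ × ℝ => (a₁ * u.1 + b₁, a₂ * u.2 + b₂)) '' C) where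
  isCompact := hC.isCompact.image (by fun_prop)
  convex := by
    rintro _ ⟨u, hu, rfl⟩ _ ⟨w, hw, rfl⟩ s t hs ht hst
    refine ⟨s • u + t • w, hC.convex hu hw hs ht hst, Prod.ext ?_ ?_⟩
    · simp only [Prod.fst_add, Prod.smul_fst, smul_eq_mul]
      linear_combination (-b₁) * hst
    · simp only [Prod.snd_add, Prod.smul_snd, smul_eq_mul]
      linear_combination (-b₂) * hst
  nonempty_interior := by
    rw [← coe_affineHomeomorph h₁ h₂, ← Homeomorph.image_interior]
    exact hC.nonempty_interior.image _

lemma map_affine_volume_real {a : ℝ} (h : a ≠ 0) (b : ℝ) :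
    Measure.map (fun x : ℝ => a * x + b) volume = ENNReal.ofReal |a⁻¹| • volume := by
  have : (fun x : ℝ => a * x + b) = (fun x => x + b) ∘ (fun x => a * x) := rfl
  rw [this, ← Measure.map_map (by fun_prop) (by fun_prop), Real.map_volume_mul_left h,
    Measure.map_smul, map_add_right_eq_self]

lemma law_affine (hC : IsBargainingSet C) (he : |e| ≤ 1) {a₁ a₂ : ℝ} (h₁ : 0 < a₁) (h₂ : 0 < a₂)
    (b₁ b₂ : ℝ) (n : ℕ) :
    law ((fun u : ℝ × ℝ => (a₁ * u.1 + b₁, a₂ * u.2 + b₂)) '' C) e n =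
      (law C e n).map fun u : ℝ × ℝ => (a₁ * u.1 + b₁, a₂ * u.2 + b₂) := by
  induction n with
  | zero =>
    refine cond_image (k := ENNReal.ofReal |a₁⁻¹| * ENNReal.ofReal |a₂⁻¹|) ?_
      (ENNReal.mul_ne_top ENNReal.ofReal_ne_top ENNReal.ofReal_ne_top)
      (affineHomeomorph h₁.ne' h₂.ne' b₁ b₂).toMeasurableEquiv ?_ C
    · simp [h₁.ne', h₂.ne']
    · rw [Homeomorph.toMeasurableEquiv_coe, coe_affineHomeomorph, Measure.volume_eq_prod]
      change Measure.map (Prod.map (fun x => a₁ * x + b₁) (fun x => a₂ * x + b₂)) _ = _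
      rw [← Measure.map_prod_map _ _ (by fun_prop) (by fun_prop), map_affine_volume_real h₁.ne',
        map_affine_volume_real h₂.ne', Measure.prod_smul_left, Measure.prod_smul_right, smul_smul]
  | succ n ih =>
    have := isProbabilityMeasure_law hC he n
    change step _ _ = (step _ _).map _
    rw [map_step _ _ (by fun_prop), ← ih]
    intro i w
    have : (a₁ * w.1.1 + b₁ < a₁ * w.2.1 + b₁ ↔ w.1.1 < w.2.1) ∧
        (a₂ * w.1.2 + b₂ < a₂ * w.2.2 + b₂ ↔ w.1.2 < w.2.2) := by
      constructor <;> simp [h₁, h₂]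
    by_cases hi : i = 0 <;> simp only [pick, payoff, hi, if_true, if_false, Prod.map, this] <;>
      split_ifs <;> rfl

/-! ### Monotonicity of the densities -/

/-- Translating upwards, in so far as one stays in `C`, increases the mass: the densities of the
distributions of the values are monotone functions on `C`. -/
lemma map_add_restrict_law_le (hC : IsBargainingSet C) (he : |e| ≤ 1) {h : ℝ × ℝ} (hh : 0 ≤ h)
    (n : ℕ) : ((law C e n).restrict {u | u ∈ C ∧ u + h ∈ C}).map (· + h) ≤ law C e n := by
  have hA : MeasurableSet {u | u ∈ C ∧ u + h ∈ C} :=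
    hC.measurableSet.inter (hC.measurableSet.preimage (measurable_add_const h))
  induction n with
  | zero =>
    refine Measure.le_iff.2 fun B hB => ?_
    have hB' := hB.preimage (measurable_add_const h)
    rw [Measure.map_apply (measurable_add_const h) hB, Measure.restrict_apply hB', law,
      ProbabilityTheory.cond_apply hC.measurableSet, ProbabilityTheory.cond_apply hC.measurableSet]
    refine mul_le_mul' le_rfl ?_
    calc volume (C ∩ ((· + h) ⁻¹' B ∩ {u | u ∈ C ∧ u + h ∈ C}))
        ≤ volume ((· + h) ⁻¹' (C ∩ B)) := measure_mono fun u hu => ⟨hu.2.2.2, hu.2.1⟩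
      _ = volume (C ∩ B) := measure_preimage_add_right _ _ _
  | succ n ih =>
    have := isProbabilityMeasure_law hC he n
    set μ := law C e n
    change ((step _ μ).restrict _).map _ ≤ step _ μ
    rw [step_eq_withDensity]
    set g := stepDensity ((1 + bias e n) / 2) μ
    have hg : Measurable g := measurable_stepDensity _ _
    refine Measure.le_iff.2 fun B hB => ?_
    have hB' := hB.preimage (measurable_add_const h)
    rw [Measure.map_apply (measurable_add_const h) hB, Measure.restrict_apply hB',
      withDensity_apply _ (hB'.inter hA), withDensity_apply _ hB]
    calc ∫⁻ u in (· + h) ⁻¹' B ∩ {u | u ∈ C ∧ u + h ∈ C}, g u ∂μ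
        ≤ ∫⁻ u in (· + h) ⁻¹' B ∩ {u | u ∈ C ∧ u + h ∈ C}, g (u + h) ∂μ :=
          lintegral_mono fun u => monotone_stepDensity _ _ (le_add_of_nonneg_right hh)
      _ = ∫⁻ u in (· + h) ⁻¹' B, g (u + h) ∂μ.restrict {u | u ∈ C ∧ u + h ∈ C} := by
          rw [Measure.restrict_restrict hB']
      _ = ∫⁻ u in B, g u ∂(μ.restrict {u | u ∈ C ∧ u + h ∈ C}).map (· + h) := by
          rw [setLIntegral_map hB hg (measurable_add_const h)]
      _ ≤ ∫⁻ u in B, g u ∂μ := lintegral_mono' (Measure.restrict_mono_measure ih B) le_rfl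

/-- For `e` near `0`, the distributions are bounded below by multiples, with factors near `1`, of
those for `e = 0`. -/
lemma smul_law_zero_le (hC : IsBargainingSet C) (he : |e| ≤ 1) (n : ℕ) :
    ENNReal.ofReal ((1 - |e|) ^ (2 ^ n - 1)) • law C 0 n ≤ law C e n := by
  induction n with
  | zero => simp [law]
  | succ n ih =>
    have := isProbabilityMeasure_law hC he n
    have := isProbabilityMeasure_law hC (e := 0) (by simp) n
    have hb := abs_le.1 (abs_bias e n).le
    have := step_mono_smul (p := (1 + bias e n) / 2) (e := |e|) (by linarith) (by linarith) ih
    change _ • step ((1 + bias 0 n) / 2) _ ≤ step _ _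
    convert this using 2
    · rw [← ENNReal.ofReal_pow (by have := sub_nonneg.2 he; positivity),
        ← ENNReal.ofReal_mul (sub_nonneg.2 he), ← pow_mul, ← pow_succ']
      congr 2
      have := Nat.one_le_two_pow (n := n)
      rw [pow_succ]
      omega
    · rw [bias_zero]; norm_num

/-! ### The tails of the marginals -/

/-- The probability that Player 1 receives more than `x`. -/
def tailX (C : Set (ℝ × ℝ)) (e : ℝ) (n : ℕ) (x : ℝ) : ℝ := (law C e n).real {u | x < u.1}

/-- The probability that Player 2 receives more than `y`. -/
def tailY (C : Set (ℝ × ℝ)) (e : ℝ) (n : ℕ) (y : ℝ) : ℝ := (law C e n).real {u | y < u.2}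

lemma measurableSet_lt_fst (x : ℝ) : MeasurableSet {u : ℝ × ℝ | x < u.1} :=
  measurableSet_lt (by fun_prop) (by fun_prop)

lemma measurableSet_lt_snd (y : ℝ) : MeasurableSet {u : ℝ × ℝ | y < u.2} :=
  measurableSet_lt (by fun_prop) (by fun_prop)

lemma measurableSet_fst_le (x : ℝ) : MeasurableSet {u : ℝ × ℝ | u.1 ≤ x} :=
  measurableSet_le (by fun_prop) (by fun_prop)

lemma measurableSet_snd_le (y : ℝ) : MeasurableSet {u : ℝ × ℝ | u.2 ≤ y} :=
  measurableSet_le (by fun_prop) (by fun_prop)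

lemma tailX_swap (hC : IsBargainingSet C) (he : |e| ≤ 1) (n : ℕ) (y : ℝ) :
    tailX (Prod.swap '' C) (-e) n y = tailY C e n y := by
  unfold tailX tailY
  rw [law_swap hC he, map_measureReal_apply measurable_swap (measurableSet_lt_fst y)]
  rfl

lemma tailX_nonneg (n : ℕ) (x : ℝ) : 0 ≤ tailX C e n x := measureReal_nonneg

lemma tailY_nonneg (n : ℕ) (y : ℝ) : 0 ≤ tailY C e n y := measureReal_nonneg

lemma tailX_le_one (hC : IsBargainingSet C) (he : |e| ≤ 1) (n : ℕ) (x : ℝ) :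
    tailX C e n x ≤ 1 :=
  have := isProbabilityMeasure_law hC he n
  measureReal_le_one

lemma tailX_antitone (hC : IsBargainingSet C) (he : |e| ≤ 1) (n : ℕ) : Antitone (tailX C e n) :=
  fun _ _ h =>
    have := isProbabilityMeasure_law hC he n
    measureReal_mono fun _ hu => lt_of_le_of_lt h hu

lemma law_real_fst_le (hC : IsBargainingSet C) (he : |e| ≤ 1) (n : ℕ) (x : ℝ) :
    (law C e n).real {u | u.1 ≤ x} = 1 - tailX C e n x := by
  have := isProbabilityMeasure_law hC he n
  rw [tailX, ← probReal_compl_eq_one_sub (measurableSet_lt_fst x)]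
  congr 1; ext u; simp

lemma law_real_snd_le (hC : IsBargainingSet C) (he : |e| ≤ 1) (n : ℕ) (y : ℝ) :
    (law C e n).real {u | u.2 ≤ y} = 1 - tailY C e n y := by
  have := isProbabilityMeasure_law hC he n
  rw [tailY, ← probReal_compl_eq_one_sub (measurableSet_lt_snd y)]
  congr 1; ext u; simp

lemma law_succ_real (hC : IsBargainingSet C) (he : |e| ≤ 1) (n : ℕ) {A : Set (ℝ × ℝ)}
    (hA : MeasurableSet A) : (law C e (n + 1)).real A =
      (1 + bias e n) / 2 * ((law C e n).prod (law C e n)).real (pick 0 ⁻¹' A) +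
        (1 - bias e n) / 2 * ((law C e n).prod (law C e n)).real (pick 1 ⁻¹' A) := by
  have := isProbabilityMeasure_law hC he n
  have hb := abs_le.1 ((abs_bias e n).trans_le he)
  rw [law, step_real (by linarith) (by linarith) _ hA]
  ring

lemma prod_real_prod_union_prod {μ : Measure (ℝ × ℝ)} [IsProbabilityMeasure μ] {A B : Set (ℝ × ℝ)}
    (hA : MeasurableSet A) (hB : MeasurableSet B) (h : Disjoint A B) :
    (μ.prod μ).real (A ×ˢ B ∪ B ×ˢ A) = 2 * (μ.real A * μ.real B) := by
  rw [measureReal_union (Set.disjoint_prod.2 (Or.inl h)) (hB.prod hA), measureReal_prod_prod,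
    measureReal_prod_prod]
  ring

/-- Player 1 chooses a payoff above `x` whenever there is one, and Player 2 has to choose one if
both payoffs are above `x`. -/
lemma tailX_succ_ge (hC : IsBargainingSet C) (he : |e| ≤ 1) (n : ℕ) (x : ℝ) :
    tailX C e n x + bias e n * (tailX C e n x * (1 - tailX C e n x)) ≤ tailX C e (n + 1) x := by
  have := isProbabilityMeasure_law hC he n
  have hb := abs_le.1 ((abs_bias e n).trans_le he)
  set r := tailX C e n x with hr
  have hL := law_real_fst_le hC he n x
  have h0 : ((law C e n).prod (law C e n)).real (pick 0 ⁻¹' {u | x < u.1}) = 1 - (1 - r) ^ 2 := by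
    have hset : pick 0 ⁻¹' {u | x < u.1} =
        ({u : ℝ × ℝ | u.1 ≤ x} ×ˢ {u : ℝ × ℝ | u.1 ≤ x})ᶜ := by
      ext w
      simp only [pick, payoff, Set.mem_preimage, Set.mem_ofPred_eq, Set.mem_compl_iff, Set.mem_prod,
        if_true]
      split_ifs <;> grind
    rw [hset, probReal_compl_eq_one_sub ((measurableSet_fst_le x).prod (measurableSet_fst_le x)),
      measureReal_prod_prod, hL, sq]
  have h1 : r ^ 2 ≤ ((law C e n).prod (law C e n)).real (pick 1 ⁻¹' {u | x < u.1}) := by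
    have : r ^ 2 = ((law C e n).prod (law C e n)).real ({u | x < u.1} ×ˢ {u | x < u.1}) := by
      rw [measureReal_prod_prod, sq]; rfl
    rw [this]
    refine measureReal_mono fun w hw => ?_
    simp only [pick, Set.mem_preimage]
    split_ifs
    exacts [hw.2, hw.1]
  have h := law_succ_real hC he n (measurableSet_lt_fst x)
  change tailX C e (n + 1) x = _ at h
  rw [h, h0]
  nlinarith

/-- A point above `(x, y)` is chosen by Player 1 over each point on the left of `x`, and by Player 2
over each point below `y`. -/
lemma law_succ_real_ge (hC : IsBargainingSet C) (he : |e| ≤ 1) (n : ℕ) {x y : ℝ}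
    {S : Set (ℝ × ℝ)} (hS : MeasurableSet S) (h : ∀ u ∈ S, x < u.1 ∧ y < u.2) :
    ((1 + bias e n) * (1 - tailX C e n x) + (1 - bias e n) * (1 - tailY C e n y)) *
      (law C e n).real S ≤ (law C e (n + 1)).real S := by
  have := isProbabilityMeasure_law hC he n
  have hb := abs_le.1 ((abs_bias e n).trans_le he)
  have h0 : 2 * ((law C e n).real S * (1 - tailX C e n x)) ≤
      ((law C e n).prod (law C e n)).real (pick 0 ⁻¹' S) := by
    rw [← law_real_fst_le hC he, ← prod_real_prod_union_prod hS (measurableSet_fst_le x)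
      (Set.disjoint_left.2 fun u hu hu' => not_lt.2 hu' (h u hu).1)]
    refine measureReal_mono ?_
    rintro w (⟨h1, h2⟩ | ⟨h1, h2⟩)
    · have := (h _ h1).1
      simp only [Set.mem_ofPred_eq] at h2
      simpa [pick, payoff, show ¬ w.1.1 < w.2.1 by linarith] using h1
    · have := (h _ h2).1
      simp only [Set.mem_ofPred_eq] at h1
      simpa [pick, payoff, show w.1.1 < w.2.1 by linarith] using h2
  have h1 : 2 * ((law C e n).real S * (1 - tailY C e n y)) ≤
      ((law C e n).prod (law C e n)).real (pick 1 ⁻¹' S) := by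
    rw [← law_real_snd_le hC he, ← prod_real_prod_union_prod hS (measurableSet_snd_le y)
      (Set.disjoint_left.2 fun u hu hu' => not_lt.2 hu' (h u hu).2)]
    refine measureReal_mono ?_
    rintro w (⟨h1, h2⟩ | ⟨h1, h2⟩)
    · have := (h _ h1).2
      simp only [Set.mem_ofPred_eq] at h2
      simpa [pick, payoff, show ¬ w.1.2 < w.2.2 by linarith] using h1
    · have := (h _ h2).2
      simp only [Set.mem_ofPred_eq] at h1
      simpa [pick, payoff, show w.1.2 < w.2.2 by linarith] using h2
  rw [law_succ_real hC he n hS]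
  nlinarith [mul_le_mul_of_nonneg_left h0 (show 0 ≤ (1 + bias e n) / 2 by linarith),
    mul_le_mul_of_nonneg_left h1 (show 0 ≤ (1 - bias e n) / 2 by linarith)]

/-! ### The threshold -/

/-- The sign of `excess b r` decides the fate of a tail `r` in a round with bias `b`: in two rounds
(with biases `b` and `-b`) the tail grows by at least `b ^ 2 * r * (1 - r) * excess b r`. -/
def excess (b r : ℝ) : ℝ := 2 * r - 1 + b * (r * (1 - r))

lemma excess_neg_one_sub (b r : ℝ) : excess (-b) (1 - r) = -excess b r := by
  unfold excess; ring

lemma excess_sub_mul {b r ρ : ℝ} : excess b r - excess b ρ = (r - ρ) * (2 + b * (1 - r - ρ)) := by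
  unfold excess; ring

lemma excess_slope_pos {b r ρ : ℝ} (hb : |b| ≤ 1) (hr : r ∈ Set.Icc (0 : ℝ) 1)
    (hρ : ρ ∈ Set.Icc (0 : ℝ) 1) : 0 < 2 + b * (1 - r - ρ) := by
  have h : |b * (1 - r - ρ)| ≤ 1 := by
    rw [abs_mul]
    exact mul_le_one₀ hb (abs_nonneg _) (abs_le.2 ⟨by linarith [hr.2, hρ.2], by
      linarith [hr.1, hρ.1]⟩)
  linarith [(abs_le.1 h).1]

lemma excess_mono {b r ρ : ℝ} (hb : |b| ≤ 1) (hr : r ∈ Set.Icc (0 : ℝ) 1)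
    (hρ : ρ ∈ Set.Icc (0 : ℝ) 1) (h : ρ ≤ r) : excess b ρ ≤ excess b r := by
  have := excess_sub_mul (b := b) (r := r) (ρ := ρ)
  nlinarith [excess_slope_pos hb hr hρ]

lemma le_of_excess_le {b r ρ : ℝ} (hb : |b| ≤ 1) (hr : r ∈ Set.Icc (0 : ℝ) 1)
    (hρ : ρ ∈ Set.Icc (0 : ℝ) 1) (h : excess b r ≤ excess b ρ) : r ≤ ρ := by
  by_contra! hlt
  have := excess_sub_mul (b := b) (r := r) (ρ := ρ)
  nlinarith [excess_slope_pos hb hr hρ, mul_pos (sub_pos.2 hlt) (excess_slope_pos hb hr hρ)]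

/-- The zeros of `excess (bias e n)` are bounded away from `0` and `1`: they alternate between some
`ρ` and `1 - ρ`. -/
lemma exists_excess_eq_zero (e : ℝ) :
    ∃ δ > 0, ∃ ρ : ℕ → ℝ, ∀ n, δ ≤ ρ n ∧ ρ n ≤ 1 - δ ∧ excess (bias e n) (ρ n) = 0 := by
  have hroot (b : ℝ) : ∃ ρ ∈ Set.Ioo (0 : ℝ) 1, excess b ρ = 0 := by
    have hc : ContinuousOn (excess b) (Set.Icc 0 1) := by unfold excess; fun_prop
    exact intermediate_value_Ioo zero_le_one hc (by simp [excess])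
  obtain ⟨ρ, ⟨h0, h1⟩, hρ⟩ := hroot e
  refine ⟨min ρ (1 - ρ), lt_min h0 (by linarith), fun n => if Even n then ρ else 1 - ρ,
    fun n => ?_⟩
  have h2 := min_le_left ρ (1 - ρ)
  have h3 := min_le_right ρ (1 - ρ)
  rcases Nat.even_or_odd n with h | h
  · simp only [h, if_true, bias, h.neg_one_pow, mul_one, hρ]
    exact ⟨h2, by linarith, trivial⟩
  · simp only [Nat.not_even_iff_odd.2 h, if_false, bias, h.neg_one_pow, mul_neg, mul_one,
      excess_neg_one_sub, hρ]
    exact ⟨h3, by linarith, neg_zero⟩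

/-- The supremum of the payoffs `x` that Player 1 is able to defend: at some depth the probability
that Player 1 receives more than `x` exceeds the threshold. -/
def critX (C : Set (ℝ × ℝ)) (e : ℝ) : ℝ := sSup {x | ∃ n, 0 < excess (bias e n) (tailX C e n x)}

/-- The supremum of the payoffs that Player 2 is able to defend. -/
def critY (C : Set (ℝ × ℝ)) (e : ℝ) : ℝ := critX (Prod.swap '' C) (-e)

lemma tailX_mem_Icc (hC : IsBargainingSet C) (he : |e| ≤ 1) (n : ℕ) (x : ℝ) :
    tailX C e n x ∈ Set.Icc (0 : ℝ) 1 := ⟨tailX_nonneg n x, tailX_le_one hC he n x⟩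

lemma tailX_eq_zero (hC : IsBargainingSet C) (he : |e| ≤ 1) (n : ℕ) {x : ℝ}
    (hx : ∀ u ∈ C, u.1 ≤ x) : tailX C e n x = 0 := by
  have := isProbabilityMeasure_law hC he n
  rw [tailX, measureReal_eq_zero_iff]
  exact measure_mono_null (fun u hu huC => not_lt.2 (hx u huC) hu) (law_compl hC he n)

lemma tailX_eq_one (hC : IsBargainingSet C) (he : |e| ≤ 1) (n : ℕ) {x : ℝ}
    (hx : ∀ u ∈ C, x < u.1) : tailX C e n x = 1 := by
  have := isProbabilityMeasure_law hC he n
  have h : (law C e n).real {u | u.1 ≤ x} = 0 := by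
    rw [measureReal_eq_zero_iff]
    exact measure_mono_null (fun u hu huC => not_lt.2 hu (hx u huC)) (law_compl hC he n)
  linarith [law_real_fst_le hC he n x]

lemma critX_set_nonempty (hC : IsBargainingSet C) (he : |e| ≤ 1) :
    {x | ∃ n, 0 < excess (bias e n) (tailX C e n x)}.Nonempty := by
  obtain ⟨a, ha⟩ := (hC.isCompact.image continuous_fst).bddBelow
  refine ⟨a - 1, 0, ?_⟩
  rw [tailX_eq_one hC he]
  · norm_num [excess]
  · intro u hu
    linarith [ha ⟨u, hu, rfl⟩]

lemma critX_set_bddAbove (hC : IsBargainingSet C) (he : |e| ≤ 1) {a : ℝ} (ha : ∀ u ∈ C, u.1 ≤ a) :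
    a ∈ upperBounds {x | ∃ n, 0 < excess (bias e n) (tailX C e n x)} := by
  rintro x ⟨n, hn⟩
  by_contra! hx
  rw [tailX_eq_zero hC he n (fun u hu => (ha u hu).trans hx.le)] at hn
  norm_num [excess] at hn

lemma exists_fst_le (hC : IsBargainingSet C) : ∃ a, ∀ u ∈ C, u.1 ≤ a := by
  obtain ⟨a, ha⟩ := (hC.isCompact.image continuous_fst).bddAbove
  exact ⟨a, fun u hu => ha ⟨u, hu, rfl⟩⟩

lemma exists_excess_pos_of_lt_critX (hC : IsBargainingSet C) (he : |e| ≤ 1) {x : ℝ}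
    (hx : x < critX C e) : ∃ n, 0 < excess (bias e n) (tailX C e n x) := by
  obtain ⟨x', ⟨n, hn⟩, hlt⟩ := exists_lt_of_lt_csSup (critX_set_nonempty hC he) hx
  refine ⟨n, hn.trans_le (excess_mono ((abs_bias e n).trans_le he) (tailX_mem_Icc hC he n x)
    (tailX_mem_Icc hC he n x') (tailX_antitone hC he n hlt.le))⟩

lemma excess_nonpos_of_critX_lt (hC : IsBargainingSet C) (he : |e| ≤ 1) {x : ℝ}
    (hx : critX C e < x) (n : ℕ) : excess (bias e n) (tailX C e n x) ≤ 0 := by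
  by_contra! h
  obtain ⟨a, ha⟩ := exists_fst_le hC
  exact not_le.2 hx (le_csSup ⟨a, critX_set_bddAbove hC he ha⟩ ⟨n, h⟩)

lemma le_critX_of_excess_pos (hC : IsBargainingSet C) (he : |e| ≤ 1) {x : ℝ} {n : ℕ}
    (h : 0 < excess (bias e n) (tailX C e n x)) : x ≤ critX C e := by
  by_contra! hx
  exact not_le.2 h (excess_nonpos_of_critX_lt hC he hx n)

lemma tailX_le_of_critX_lt (hC : IsBargainingSet C) (he : |e| ≤ 1) {x ρ : ℝ} {n : ℕ}
    (hρ : ρ ∈ Set.Icc (0 : ℝ) 1) (h : excess (bias e n) ρ = 0) (hx : critX C e < x) :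
    tailX C e n x ≤ ρ :=
  le_of_excess_le ((abs_bias e n).trans_le he) (tailX_mem_Icc hC he n x) hρ
    (h ▸ excess_nonpos_of_critX_lt hC he hx n)

lemma tailY_le_of_critY_lt (hC : IsBargainingSet C) (he : |e| ≤ 1) {y ρ : ℝ} {n : ℕ}
    (hρ : ρ ∈ Set.Icc (0 : ℝ) 1) (h : excess (bias e n) ρ = 0) (hy : critY C e < y) :
    tailY C e n y ≤ 1 - ρ := by
  rw [← tailX_swap hC he]
  refine tailX_le_of_critX_lt hC.swap (by rwa [abs_neg])
    ⟨by linarith [hρ.2], by linarith [hρ.1]⟩ ?_ hy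
  rw [bias_neg, excess_neg_one_sub, h, neg_zero]

lemma law_zero_real_pos (hC : IsBargainingSet C) {S : Set (ℝ × ℝ)} (hS : IsOpen S)
    (hne : S.Nonempty) (hSC : S ⊆ C) : 0 < (law C e 0).real S := by
  have := hC.isProbabilityMeasure_cond
  change 0 < (ProbabilityTheory.cond volume C).real S
  rw [measureReal_def, ENNReal.toReal_pos_iff]
  refine ⟨?_, measure_lt_top _ _⟩
  rw [ProbabilityTheory.cond_apply hC.measurableSet, Set.inter_eq_right.2 hSC]
  exact ENNReal.mul_pos (ENNReal.inv_ne_zero.2 hC.isCompact.measure_lt_top.ne)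
    (hS.measure_pos volume hne).ne'

/-- No feasible point is above both thresholds: otherwise the mass of a small box above them would
grow exponentially. -/
lemma not_crit_lt (hC : IsBargainingSet C) (he : |e| ≤ 1) {u : ℝ × ℝ} (hu : u ∈ C)
    (hx : critX C e < u.1) : u.2 ≤ critY C e := by
  by_contra! hy
  have hopen : IsOpen {v : ℝ × ℝ | critX C e < v.1 ∧ critY C e < v.2} :=
    (isOpen_lt continuous_const continuous_fst).and (isOpen_lt continuous_const continuous_snd)
  obtain ⟨w, hw, hwC⟩ :
      ({v : ℝ × ℝ | critX C e < v.1 ∧ critY C e < v.2} ∩ interior C).Nonempty := by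
    refine mem_closure_iff.1 ?_ _ hopen ⟨hx, hy⟩
    rw [hC.convex.closure_interior_eq_closure_of_nonempty_interior hC.nonempty_interior]
    exact subset_closure hu
  obtain ⟨η, hη, hball⟩ := Metric.isOpen_iff.1 (hopen.inter isOpen_interior) w ⟨hw, hwC⟩
  have hbox {a b : ℝ} (ha : |a - w.1| < η) (hb : |b - w.2| < η) :
      (a, b) ∈ {v : ℝ × ℝ | critX C e < v.1 ∧ critY C e < v.2} ∩ interior C :=
    hball (by rw [Metric.mem_ball, Prod.dist_eq]; exact max_lt ha hb)
  set x := w.1 - η / 2 with hxdef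
  set y := w.2 - η / 2 with hydef
  have hxy := (hbox (a := x) (b := y) (by rw [abs_lt]; constructor <;> linarith)
    (by rw [abs_lt]; constructor <;> linarith)).1
  set L : Set (ℝ × ℝ) := Set.Ioo x w.1 ×ˢ Set.Ioo y w.2 with hL
  set S : Set (ℝ × ℝ) := Set.Ioo w.1 (w.1 + η) ×ˢ Set.Ioo w.2 (w.2 + η) with hS
  have hLo : IsOpen L := isOpen_Ioo.prod isOpen_Ioo
  have hSo : IsOpen S := isOpen_Ioo.prod isOpen_Ioo
  have hLC : L ⊆ C := by
    rintro v ⟨⟨h1, h2⟩, h3, h4⟩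
    exact interior_subset (hbox (a := v.1) (b := v.2) (by rw [abs_lt]; constructor <;> linarith)
      (by rw [abs_lt]; constructor <;> linarith)).2
  have hSC : S ⊆ C := by
    rintro v ⟨⟨h1, h2⟩, h3, h4⟩
    exact interior_subset (hbox (a := v.1) (b := v.2) (by rw [abs_lt]; constructor <;> linarith)
      (by rw [abs_lt]; constructor <;> linarith)).2
  have hLpos := law_zero_real_pos (e := e) hC hLo
    ((Set.nonempty_Ioo.2 (by linarith)).prod (Set.nonempty_Ioo.2 (by linarith))) hLC
  have hSpos := law_zero_real_pos (e := e) hC hSo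
    ((Set.nonempty_Ioo.2 (by linarith)).prod (Set.nonempty_Ioo.2 (by linarith))) hSC
  set β := (law C e 0).real L
  obtain ⟨δ, hδ, ρ, hρ⟩ := exists_excess_eq_zero e
  have hρI (n) : ρ n ∈ Set.Icc (0 : ℝ) 1 :=
    ⟨by linarith [(hρ n).1], by linarith [(hρ n).2.1]⟩
  -- The mass of a box above the thresholds grows, because `b * (1 - 2 * ρ) = b ^ 2 * ρ * (1 - ρ)`
  -- for the zero `ρ` of `excess b`.
  have hfac (n) : 0 ≤ bias e n * (1 - 2 * ρ n) := by
    have h := (hρ n).2.2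
    have h' : bias e n * (1 - 2 * ρ n) = bias e n ^ 2 * (ρ n * (1 - ρ n)) := by
      unfold excess at h; linear_combination (-bias e n) * h
    rw [h']
    exact mul_nonneg (sq_nonneg _) (mul_nonneg (hρI n).1 (sub_nonneg.2 (hρI n).2))
  have hLn (n) : β ≤ (law C e n).real L := by
    induction n with
    | zero => exact le_rfl
    | succ n ih =>
      have hb := abs_le.1 ((abs_bias e n).trans_le he)
      have h1 := tailX_le_of_critX_lt hC he (hρI n) (hρ n).2.2 hxy.1
      have h2 := tailY_le_of_critY_lt hC he (hρI n) (hρ n).2.2 hxy.2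
      have h3 := law_succ_real_ge hC he n (x := x) (y := y) hLo.measurableSet
        (fun v hv => ⟨hv.1.1, hv.2.1⟩)
      refine (ih.trans ?_).trans h3
      refine le_mul_of_one_le_left measureReal_nonneg ?_
      nlinarith [hfac n, mul_le_mul_of_nonneg_left h1 (show 0 ≤ 1 + bias e n by linarith),
        mul_le_mul_of_nonneg_left h2 (show 0 ≤ 1 - bias e n by linarith)]
  have hSn (n) : (1 + 2 * β) ^ n * (law C e 0).real S ≤ (law C e n).real S := by
    induction n with
    | zero => simp
    | succ n ih =>
      have := isProbabilityMeasure_law hC he n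
      have hb := abs_le.1 ((abs_bias e n).trans_le he)
      have h1 := tailX_le_of_critX_lt hC he (hρI n) (hρ n).2.2 hxy.1
      have h2 := tailY_le_of_critY_lt hC he (hρI n) (hρ n).2.2 hxy.2
      have h1' : tailX C e n w.1 + (law C e n).real L ≤ tailX C e n x := by
        unfold tailX
        rw [← measureReal_union ?_ hLo.measurableSet]
        · refine measureReal_mono ?_
          rintro v (hv | hv)
          · exact (show x < w.1 by linarith).trans hv
          · exact hv.1.1
        · exact Set.disjoint_left.2 fun v hv hv' => lt_asymm hv hv'.1.2
      have h2' : tailY C e n w.2 + (law C e n).real L ≤ tailY C e n y := by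
        unfold tailY
        rw [← measureReal_union ?_ hLo.measurableSet]
        · refine measureReal_mono ?_
          rintro v (hv | hv)
          · exact (show y < w.2 by linarith).trans hv
          · exact hv.2.1
        · exact Set.disjoint_left.2 fun v hv hv' => lt_asymm hv hv'.2.2
      have h3 := law_succ_real_ge hC he n (x := w.1) (y := w.2) hSo.measurableSet
        (fun v hv => ⟨hv.1.1, hv.2.1⟩)
      have h4 := hLn n
      have h5 : tailX C e n w.1 ≤ ρ n - β := by linarith
      have h6 : tailY C e n w.2 ≤ 1 - ρ n - β := by linarith
      have h7 : 1 + 2 * β ≤ (1 + bias e n) * (1 - tailX C e n w.1) +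
          (1 - bias e n) * (1 - tailY C e n w.2) := by
        nlinarith [hfac n, mul_le_mul_of_nonneg_left h5 (show 0 ≤ 1 + bias e n by linarith),
          mul_le_mul_of_nonneg_left h6 (show 0 ≤ 1 - bias e n by linarith)]
      refine le_trans ?_ h3
      rw [pow_succ', mul_assoc]
      exact mul_le_mul h7 ih (by positivity) (by linarith)
  have hlim : Tendsto (fun n => (1 + 2 * β) ^ n * (law C e 0).real S) atTop atTop :=
    (tendsto_pow_atTop_atTop_of_one_lt (by linarith)).atTop_mul_const hSpos
  obtain ⟨n, hn⟩ := (hlim.eventually_gt_atTop 1).exists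
  have := isProbabilityMeasure_law hC he n
  exact absurd ((hn.trans_le (hSn n)).trans_le measureReal_le_one) (lt_irrefl _)

/-! ### Tails below the threshold tend to one if the bias does not vanish -/

lemma excess_two_rounds {b r r₁ r₂ : ℝ} (hb : |b| ≤ 1) (hr : r ∈ Set.Icc (0 : ℝ) 1)
    (hr₁ : r₁ ∈ Set.Icc (0 : ℝ) 1) (h₁ : r + b * (r * (1 - r)) ≤ r₁)
    (h₂ : r₁ + -b * (r₁ * (1 - r₁)) ≤ r₂) : r + b ^ 2 * (r * (1 - r)) * excess b r ≤ r₂ := by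
  have hb' := abs_le.1 hb
  set s := r + b * (r * (1 - r)) with hs
  have hp : 0 ≤ r * (1 - r) := mul_nonneg hr.1 (sub_nonneg.2 hr.2)
  have hs0 : 0 ≤ s := by nlinarith [hr.1, hr.2]
  have hs1 : s ≤ 1 := by nlinarith [hr.1, hr.2]
  -- The round with bias `-b` is a monotone function of the tail.
  have hmono : s + -b * (s * (1 - s)) ≤ r₁ + -b * (r₁ * (1 - r₁)) := by
    have h : 0 ≤ 1 - b * (1 - r₁ - s) := by
      have : |b * (1 - r₁ - s)| ≤ 1 := by
        rw [abs_mul]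
        exact mul_le_one₀ hb (abs_nonneg _) (abs_le.2 ⟨by linarith [hr₁.2], by linarith [hr₁.1]⟩)
      linarith [(abs_le.1 this).2]
    nlinarith [mul_nonneg (sub_nonneg.2 h₁) h]
  have : r + b ^ 2 * (r * (1 - r)) * excess b r = s + -b * (s * (1 - s)) := by
    rw [hs]; unfold excess; ring
  linarith

lemma tendsto_tailX_one (hC : IsBargainingSet C) (he : |e| ≤ 1) (he0 : e ≠ 0) {x : ℝ}
    (hx : x < critX C e) : Tendsto (fun n => tailX C e n x) atTop (𝓝 1) := by
  obtain ⟨n₀, hn₀⟩ := exists_excess_pos_of_lt_critX hC he hx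
  set b := bias e n₀ with hb
  have hb1 : |b| ≤ 1 := (abs_bias e n₀).trans_le he
  have hb2 : 0 < b ^ 2 := by rw [hb, bias_sq]; positivity
  have hb3 : b ^ 2 ≤ 1 := by rw [← sq_abs]; exact pow_le_one₀ (abs_nonneg _) hb1
  have hbk (k : ℕ) : bias e (n₀ + 2 * k) = b := by
    induction k with
    | zero => rfl
    | succ k ih => rw [show n₀ + 2 * (k + 1) = n₀ + 2 * k + 1 + 1 by ring, bias_succ, bias_succ,
        neg_neg, ih]
  have hI := fun n => tailX_mem_Icc hC he n x
  set a : ℕ → ℝ := fun k => tailX C e (n₀ + 2 * k) x with ha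
  set q := excess b (a 0) with hq
  have hq0 : 0 < q := hn₀
  have ha0 : 0 < a 0 := by
    by_contra! h
    have : a 0 = 0 := le_antisymm h (hI _).1
    rw [hq, this] at hq0
    norm_num [excess] at hq0
  have hstep (k : ℕ) : a k + b ^ 2 * (a k * (1 - a k)) * excess b (a k) ≤ a (k + 1) := by
    have h1 := tailX_succ_ge hC he (n₀ + 2 * k) x
    have h2 := tailX_succ_ge hC he (n₀ + 2 * k + 1) x
    rw [bias_succ] at h2
    rw [hbk] at h1 h2
    exact excess_two_rounds hb1 (hI _) (hI _) h1 h2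
  have hge (k : ℕ) : a 0 ≤ a k := by
    induction k with
    | zero => exact le_rfl
    | succ k ih =>
      have h1 : q ≤ excess b (a k) := excess_mono hb1 (hI _) (hI _) ih
      refine ih.trans (le_trans ?_ (hstep k))
      have h2 := mul_nonneg (hI (n₀ + 2 * k)).1 (sub_nonneg.2 (hI (n₀ + 2 * k)).2)
      have := mul_nonneg (mul_nonneg hb2.le h2) (hq0.le.trans h1)
      simp only [ha] at this ⊢
      linarith
  set c := b ^ 2 * a 0 * q with hc
  have hc0 : 0 < c := by positivity
  have hgeom (k : ℕ) : 1 - a k ≤ (1 - c) ^ k ∧ 0 ≤ 1 - c := by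
    have hc1 : c ≤ 1 := by
      have hq1 : q ≤ 1 := by
        have := excess_mono (b := b) (r := 1) (ρ := a 0) hb1 ⟨zero_le_one, le_rfl⟩ (hI _) (hI _).2
        exact this.trans_eq (by norm_num [excess])
      exact mul_le_one₀ (mul_le_one₀ hb3 ha0.le (hI _).2) hq0.le hq1
    refine ⟨?_, by linarith⟩
    induction k with
    | zero => simpa using ha0.le
    | succ k ih =>
      have h1 : q ≤ excess b (a k) := excess_mono hb1 (hI _) (hI _) (hge k)
      have h2 : c ≤ b ^ 2 * a k * excess b (a k) := by
        have := hge k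
        rw [hc]
        gcongr
        exact mul_nonneg hb2.le (ha0.le.trans this)
      have h3 : 0 ≤ 1 - a k := sub_nonneg.2 (hI _).2
      have h4 := hstep k
      have h5 := mul_le_mul_of_nonneg_right h2 h3
      have h6 := mul_le_mul_of_nonneg_right ih (show 0 ≤ 1 - c by linarith)
      rw [pow_succ]
      linarith
  have hlim : Tendsto (fun k : ℕ => 2 * (1 - c) ^ k) atTop (𝓝 0) := by
    simpa using (tendsto_pow_atTop_nhds_zero_of_lt_one (hgeom 0).2
      (show 1 - c < 1 by linarith)).const_mul 2
  rw [Metric.tendsto_atTop]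
  intro η hη
  obtain ⟨K, hK⟩ := eventually_atTop.1 (hlim.eventually_lt_const hη)
  refine ⟨n₀ + 2 * K, fun n hn => ?_⟩
  obtain ⟨k, hk⟩ : ∃ k, n = n₀ + 2 * k ∨ n = n₀ + 2 * k + 1 := ⟨(n - n₀) / 2, by omega⟩
  have h1 := hK k (by omega)
  have h2 := (hgeom k).1
  have h3 : 1 - tailX C e n x ≤ 2 * (1 - a k) := by
    have h4 : 0 ≤ 1 - a k := sub_nonneg.2 (hI _).2
    rcases hk with rfl | rfl
    · simp only [ha] at h4 ⊢
      linarith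
    · have h5 := tailX_succ_ge hC he (n₀ + 2 * k) x
      rw [hbk] at h5
      change a k + b * (a k * (1 - a k)) ≤ _ at h5
      have h6 : 0 ≤ a k := (hI _).1
      nlinarith [(abs_le.1 hb1).1, mul_nonneg h6 h4, mul_nonneg h4 h4]
  rw [Real.dist_eq, abs_sub_comm, abs_of_nonneg (sub_nonneg.2 (hI n).2)]
  linarith

lemma tendsto_tailY_one (hC : IsBargainingSet C) (he : |e| ≤ 1) (he0 : e ≠ 0) {y : ℝ}
    (hy : y < critY C e) : Tendsto (fun n => tailY C e n y) atTop (𝓝 1) := by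
  simp_rw [← tailX_swap hC he]
  exact tendsto_tailX_one hC.swap (by rwa [abs_neg]) (neg_ne_zero.2 he0) hy

/-! ### Vertical edges of the feasible set -/

lemma IsBargainingSet.exists_fst_lt (hC : IsBargainingSet C) {a : ℝ} (ha : ∀ u ∈ C, u.1 ≤ a) :
    ∃ u ∈ C, u.1 < a := by
  obtain ⟨w, hw⟩ := hC.nonempty_interior
  obtain ⟨η, hη, hball⟩ := Metric.isOpen_iff.1 isOpen_interior w hw
  refine ⟨w, interior_subset hw, ?_⟩
  have : (w.1 + η / 2, w.2) ∈ interior C := hball (by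
    rw [Metric.mem_ball, Prod.dist_eq, Real.dist_eq, Real.dist_eq]
    simp only [add_sub_cancel_left, sub_self, abs_zero]
    exact max_lt (by rw [abs_of_pos (half_pos hη)]; exact half_lt_self hη) hη)
  have := ha _ (interior_subset this)
  simp only at this
  linarith

/-- Near a vertical edge on the right of the feasible set one stays in the set when moving upwards
to any height below the upper end of the edge. -/
lemma exists_strip (hC : IsBargainingSet C) {v : ℝ × ℝ} (hv : v ∈ C) (hmax : ∀ u ∈ C, u.1 ≤ v.1)
    {z : ℝ} (hz : z < v.2) : ∃ x < v.1, ∀ u ∈ C, x < u.1 → ∀ h, 0 ≤ h → u.2 + h ≤ z →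
      u + (0, h) ∈ C := by
  obtain ⟨w, hw, hlt⟩ := hC.exists_fst_lt hmax
  have hd : 0 < v.1 - w.1 := sub_pos.2 hlt
  set θ₀ := min 1 ((v.2 - z) / (1 + |w.2 - v.2|)) with hθ₀
  have hθ₀pos : 0 < θ₀ := lt_min one_pos (div_pos (by linarith) (by positivity))
  refine ⟨v.1 - θ₀ * (v.1 - w.1), by nlinarith, fun u hu hx h hh hz' => ?_⟩
  set θ := (v.1 - u.1) / (v.1 - w.1) with hθ
  have hθd : θ * (v.1 - w.1) = v.1 - u.1 := div_mul_cancel₀ _ hd.ne'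
  have hθ0 : 0 ≤ θ := div_nonneg (sub_nonneg.2 (hmax u hu)) hd.le
  have hθ1 : θ < θ₀ := by rw [hθ, div_lt_iff₀ hd]; linarith
  have hθ2 : θ ≤ 1 := hθ1.le.trans (min_le_left _ _)
  have hθ3 : θ * (1 + |w.2 - v.2|) ≤ v.2 - z := by
    rw [← le_div_iff₀ (by positivity)]
    exact hθ1.le.trans (min_le_right _ _)
  set t := v.2 + θ * (w.2 - v.2) with ht
  have htz : z ≤ t := by
    have := mul_le_mul_of_nonneg_left (neg_abs_le (w.2 - v.2)) hθ0
    nlinarith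
  have hutC : (u.1, t) ∈ C := by
    have := hC.convex hv hw (sub_nonneg.2 hθ2) hθ0 (by ring)
    convert this using 1
    ext
    · simp; linarith
    · simp [ht]; ring
  rcases hh.eq_or_lt with rfl | hpos
  · have : u + (0, 0) = u := by ext <;> simp
    rwa [this]
  · have hut : 0 < t - u.2 := by linarith
    have hs1 : h / (t - u.2) ≤ 1 := by rw [div_le_one hut]; linarith
    have := hC.convex hu hutC (sub_nonneg.2 hs1) (div_nonneg hh hut.le) (by ring)
    convert this using 1
    ext
    · simp only [Prod.fst_add, Prod.smul_fst, smul_eq_mul]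
      ring
    · simp only [Prod.snd_add, Prod.smul_snd, smul_eq_mul]
      field_simp
      ring

/-- A set has at most the mass of a set that contains its translate by `h ≥ 0`, if the translate
stays in `C`. -/
lemma law_real_le_of_add (hC : IsBargainingSet C) (he : |e| ≤ 1) (n : ℕ) {A B : Set (ℝ × ℝ)}
    (hB : MeasurableSet B) {h : ℝ × ℝ} (hh : 0 ≤ h)
    (hAB : ∀ u ∈ A, u ∈ C → u + h ∈ C ∧ u + h ∈ B) : (law C e n).real A ≤ (law C e n).real B := by
  have := isProbabilityMeasure_law hC he n
  refine ENNReal.toReal_mono (measure_ne_top _ _) ?_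
  have hle := map_add_restrict_law_le hC he hh n B
  rw [Measure.map_apply (measurable_add_const h) hB,
    Measure.restrict_apply (hB.preimage (measurable_add_const h))] at hle
  refine le_trans (measure_mono_ae ?_) hle
  filter_upwards [ae_mem_law hC he n] with u hu hA
  exact ⟨(hAB u hA hu).2, hu, (hAB u hA hu).1⟩

/-- If the bias does not vanish, then the payoff of Player 2 concentrates near its threshold as soon
as Player 1 obtains the highest payoff. As the densities are monotone, this is impossible below
the upper end of a vertical edge. -/
lemma snd_le_critY_of_ne_zero (hC : IsBargainingSet C) (he : |e| ≤ 1) (he0 : e ≠ 0) {v : ℝ × ℝ}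
    (hv : v ∈ C) (hmax : ∀ u ∈ C, u.1 ≤ v.1) (hx : v.1 ≤ critX C e) : v.2 ≤ critY C e := by
  by_contra! hy
  obtain ⟨δ, hδ, ρ, hρ⟩ := exists_excess_eq_zero e
  obtain ⟨K, hK⟩ := exists_nat_gt (2 / δ)
  obtain ⟨z, hz1, hz2⟩ := exists_between hy
  obtain ⟨x, hxv, hstrip⟩ := exists_strip hC hv hmax hz2
  set s := (z - critY C e) / (K + 1) with hs
  have hs0 : 0 < s := div_pos (by linarith) (by positivity)
  have hsK : s * (K + 1) = z - critY C e := div_mul_cancel₀ _ (by positivity)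
  set a := critY C e - s / 2 with ha
  -- A slab around the threshold of Player 2 in the strip next to the edge, and its translates.
  set E : ℕ → Set (ℝ × ℝ) := fun k => {u | x < u.1} ∩ {u | a + k * s < u.2 ∧ u.2 ≤ a + k * s + s}
    with hE
  have hEm (k) : MeasurableSet (E k) := (measurableSet_lt_fst x).inter
    ((measurableSet_lt_snd _).inter (measurableSet_snd_le _))
  have hshift (n k : ℕ) (hk : k < K) : (law C e n).real (E 0) ≤ (law C e n).real (E k) := by
    refine law_real_le_of_add hC he n (hEm k) (h := (0, k * s))
      ⟨le_rfl, by simp only [Prod.snd_zero]; positivity⟩ ?_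
    rintro u ⟨h1, h2, h3⟩ hu
    simp only [CharP.cast_eq_zero, zero_mul, add_zero] at h2 h3
    have hkK : (k : ℝ) * s ≤ K * s := by gcongr
    refine ⟨hstrip u hu h1 _ (by positivity) (by linarith), ?_, ?_, ?_⟩
    · simpa using h1
    · simp only [Prod.snd_add]; linarith
    · simp only [Prod.snd_add]; linarith
  have hsum (n : ℕ) : K * (law C e n).real (E 0) ≤ 1 := by
    have := isProbabilityMeasure_law hC he n
    have hdisj : Set.PairwiseDisjoint (↑(Finset.range K)) E := by
      intro i _ j _ hij
      refine Set.disjoint_left.2 ?_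
      rintro u ⟨-, h1, h2⟩ ⟨-, h3, h4⟩
      rcases lt_or_gt_of_ne hij with h | h
      · have : (i : ℝ) + 1 ≤ j := by exact_mod_cast h
        nlinarith
      · have : (j : ℝ) + 1 ≤ i := by exact_mod_cast h
        nlinarith
    calc K * (law C e n).real (E 0) = ∑ _k ∈ Finset.range K, (law C e n).real (E 0) := by simp
      _ ≤ ∑ k ∈ Finset.range K, (law C e n).real (E k) :=
          Finset.sum_le_sum fun k hk => hshift n k (Finset.mem_range.1 hk)
      _ = (law C e n).real (⋃ k ∈ Finset.range K, E k) :=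
          (measureReal_biUnion_finset hdisj fun k _ => hEm k).symm
      _ ≤ 1 := measureReal_le_one
  have h1 := (tendsto_tailX_one hC he he0 (hxv.trans_le hx)).eventually_const_lt
    (show 1 - δ / 4 < 1 by linarith)
  have h2 := (tendsto_tailY_one hC he he0 (y := a) (by linarith)).eventually_const_lt
    (show 1 - δ / 4 < 1 by linarith)
  obtain ⟨n, hn1, hn2⟩ := (h1.and h2).exists
  have h3 : tailY C e n (a + s) ≤ 1 - ρ n :=
    tailY_le_of_critY_lt hC he ⟨by linarith [(hρ n).1], by linarith [(hρ n).2.1]⟩ (hρ n).2.2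
      (by linarith)
  have h4 : 1 ≤ (law C e n).real (E 0) + (1 - tailX C e n x) + (1 - tailY C e n a) +
      tailY C e n (a + s) := by
    have := isProbabilityMeasure_law hC he n
    rw [← law_real_fst_le hC he, ← law_real_snd_le hC he, ← probReal_univ (μ := law C e n)]
    have hcover : (Set.univ : Set (ℝ × ℝ)) ⊆
        ((E 0 ∪ {u | u.1 ≤ x}) ∪ {u | u.2 ≤ a}) ∪ {u | a + s < u.2} := by
      intro u _
      by_cases h1 : u.1 ≤ x
      · exact Or.inl (Or.inl (Or.inr h1))
      by_cases h2 : u.2 ≤ a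
      · exact Or.inl (Or.inr h2)
      by_cases h3 : a + s < u.2
      · exact Or.inr h3
      · refine Or.inl (Or.inl (Or.inl ⟨not_le.1 h1, ?_, ?_⟩))
        · simpa using h2
        · simpa using h3
    refine (measureReal_mono hcover).trans ((measureReal_union_le _ _).trans ?_)
    gcongr
    · refine (measureReal_union_le _ _).trans ?_
      gcongr
      exact measureReal_union_le _ _
    · exact le_rfl
  have h5 : δ / 2 ≤ (law C e n).real (E 0) := by linarith [(hρ n).1]
  have h6 := hsum n
  rw [div_lt_iff₀ hδ] at hK
  nlinarith [mul_le_mul_of_nonneg_left h5 (Nat.cast_nonneg (α := ℝ) K)]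

lemma continuous_tailX (hC : IsBargainingSet C) (he : |e| ≤ 1) (n : ℕ) :
    Continuous (tailX C e n) := by
  have := isProbabilityMeasure_law hC he n
  refine continuous_iff_continuousAt.2 fun x₀ => ?_
  refine (ENNReal.tendsto_toReal (measure_ne_top _ _)).comp
    (tendsto_measure_of_ae_tendsto_indicator_of_isFiniteMeasure (𝓝 x₀) (measurableSet_lt_fst x₀)
      (fun x => measurableSet_lt_fst x) ?_)
  have hnull : (volume : Measure (ℝ × ℝ)) {u | u.1 = x₀} = 0 := by
    have : {u : ℝ × ℝ | u.1 = x₀} = {x₀} ×ˢ Set.univ := by ext u; simp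
    rw [this, Measure.volume_eq_prod, Measure.prod_prod]
    simp
  have hae : ∀ᵐ u ∂law C e n, u.1 ≠ x₀ := by
    refine law_absolutelyContinuous hC he n ?_
    convert hnull using 2
    ext u
    simp
  filter_upwards [hae] with u hu
  rcases lt_or_gt_of_ne hu with h | h
  · filter_upwards [lt_mem_nhds h] with x hx
    exact ⟨fun h' => absurd hx (lt_asymm h'), fun h' => absurd h (lt_asymm h')⟩
  · filter_upwards [gt_mem_nhds h] with x hx
    exact ⟨fun _ => h, fun _ => hx⟩

/-- Under fair control of the nodes a tail of Player 2 increases whenever both players agree on the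
better one of two payoff profiles. -/
lemma tailY_zero_succ_ge (hC : IsBargainingSet C) (n : ℕ) (x y : ℝ) :
    tailY C 0 n y + (law C 0 n).real {u | x < u.1 ∧ y < u.2} *
      (law C 0 n).real {u | u.1 ≤ x ∧ u.2 ≤ y} ≤ tailY C 0 (n + 1) y := by
  have he : |(0 : ℝ)| ≤ 1 := by simp
  have := isProbabilityMeasure_law hC he n
  set μ := law C 0 n
  set T : Set (ℝ × ℝ) := {u | y < u.2} with hT
  set M : Set (ℝ × ℝ) := {u | x < u.1 ∧ y < u.2} with hM
  set D : Set (ℝ × ℝ) := {u | u.1 ≤ x ∧ u.2 ≤ y} with hD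
  set t := tailY C 0 n y with ht
  have hTm : MeasurableSet T := measurableSet_lt_snd y
  have hMm : MeasurableSet M := (measurableSet_lt_fst x).inter (measurableSet_lt_snd y)
  have hDm : MeasurableSet D := (measurableSet_fst_le x).inter (measurableSet_snd_le y)
  have h1 : (μ.prod μ).real (pick 1 ⁻¹' T) = 1 - (1 - t) ^ 2 := by
    have hset : pick 1 ⁻¹' T = ({u : ℝ × ℝ | u.2 ≤ y} ×ˢ {u : ℝ × ℝ | u.2 ≤ y})ᶜ := by
      ext w
      simp only [pick, payoff, Set.mem_preimage, hT, Set.mem_ofPred_eq, Set.mem_compl_iff,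
        Set.mem_prod, one_ne_zero, if_false]
      split_ifs <;> grind
    rw [hset, probReal_compl_eq_one_sub ((measurableSet_snd_le y).prod (measurableSet_snd_le y)),
      measureReal_prod_prod, law_real_snd_le hC he, sq]
  have h0 : t ^ 2 + 2 * (μ.real M * μ.real D) ≤ (μ.prod μ).real (pick 0 ⁻¹' T) := by
    have hMD : Disjoint M D := Set.disjoint_left.2 fun u h h' => not_lt.2 h'.1 h.1
    have hTT : t ^ 2 = (μ.prod μ).real (T ×ˢ T) := by rw [measureReal_prod_prod, sq]; rfl
    rw [hTT, ← prod_real_prod_union_prod hMm hDm hMD,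
      ← measureReal_union ?_ ((hMm.prod hDm).union (hDm.prod hMm))]
    · refine measureReal_mono ?_
      rintro w (⟨h1, h2⟩ | ⟨h1, h2⟩ | ⟨h1, h2⟩)
      · simp only [pick, Set.mem_preimage]
        split_ifs
        exacts [h2, h1]
      · have : ¬ w.1.1 < w.2.1 := not_lt.2 (h2.1.trans h1.1.le)
        simpa [pick, payoff, this, hT] using h1.2
      · have : w.1.1 < w.2.1 := h1.1.trans_lt h2.1
        simpa [pick, payoff, this, hT] using h2.2
    · rw [Set.disjoint_left]
      rintro w ⟨h1, h2⟩ (⟨h3, h4⟩ | ⟨h3, h4⟩)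
      · exact not_lt.2 h4.2 h2
      · exact not_lt.2 h3.2 h1
  have h := law_succ_real hC he n hTm
  change tailY C 0 (n + 1) y = _ at h
  rw [h, h1, bias_zero]
  nlinarith

lemma excess_zero (r : ℝ) : excess 0 r = 2 * r - 1 := by simp [excess]

lemma tailX_zero_monotone (hC : IsBargainingSet C) (x : ℝ) : Monotone fun n => tailX C 0 n x :=
  monotone_nat_of_le_succ fun n => by
    simpa [bias_zero] using tailX_succ_ge hC (e := 0) (by simp) n x

/-- Under fair control of the nodes, agreement of the players about points in the strip next to a
vertical edge would increase the tail of Player 2 by a fixed amount in every round, if it were to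
stay below one half at a height below the upper end of the edge. -/
lemma snd_le_critY_zero (hC : IsBargainingSet C) {v : ℝ × ℝ}
    (hv : v ∈ C) (hmax : ∀ u ∈ C, u.1 ≤ v.1) (hx : v.1 ≤ critX C 0) : v.2 ≤ critY C 0 := by
  by_contra! hy
  have he : |(0 : ℝ)| ≤ 1 := by simp
  obtain ⟨y, hy1, hy2⟩ := exists_between hy
  obtain ⟨z, hz1, hz2⟩ := exists_between hy2
  obtain ⟨x, hxv, hstrip⟩ := exists_strip hC hv hmax hz2
  obtain ⟨b, hb⟩ := (hC.isCompact.image continuous_snd).bddBelow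
  set s := z - y with hs
  have hs0 : 0 < s := sub_pos.2 hz1
  obtain ⟨J, hJ⟩ := exists_nat_gt ((y - b) / s)
  rw [div_lt_iff₀ hs0] at hJ
  obtain ⟨N, hN⟩ := exists_excess_pos_of_lt_critX hC he (hxv.trans_le hx)
  rw [bias_zero, excess_zero] at hN
  have hty (n) : tailY C 0 n y ≤ 1 / 2 := by
    have := tailY_le_of_critY_lt hC he (n := n) (ρ := 1 / 2) ⟨by norm_num, by norm_num⟩
      (by rw [bias_zero, excess_zero]; norm_num) hy1
    linarith
  set κ : ℝ := 1 / (16 * (1 + J)) with hκ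
  have hκ0 : 0 < κ := by positivity
  have hinc (n : ℕ) (hn : N ≤ n) : tailY C 0 n y + κ ≤ tailY C 0 (n + 1) y := by
    have := isProbabilityMeasure_law hC he n
    have hrx : 1 / 4 ≤ tailX C 0 n x := by
      have : tailX C 0 N x ≤ tailX C 0 n x := tailX_zero_monotone hC x hn
      linarith
    obtain ⟨x', ⟨hx1, -⟩, hx'⟩ : (1 / 4 : ℝ) ∈ tailX C 0 n '' Set.Icc x v.1 :=
      intermediate_value_Icc' hxv.le (continuous_tailX hC he n).continuousOn
        ⟨by rw [tailX_eq_zero hC he n hmax]; norm_num, hrx⟩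
    set m := (law C 0 n).real {u | x' < u.1 ∧ y < u.2} with hm
    set F : ℕ → Set (ℝ × ℝ) := fun j =>
      {u | x' < u.1 ∧ y - (j + 1) * s < u.2 ∧ u.2 ≤ y - j * s} with hF
    have hFm (j : ℕ) : (law C 0 n).real (F j) ≤ m := by
      refine law_real_le_of_add hC he n (h := (0, (j + 1) * s))
        ((measurableSet_lt_fst _).inter (measurableSet_lt_snd _))
        ⟨le_rfl, by simp only [Prod.snd_zero]; positivity⟩ ?_
      rintro u ⟨h1, h2, h3⟩ hu
      refine ⟨hstrip u hu (hx1.trans_lt h1) _ (by positivity) (by linarith), ?_, ?_⟩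
      · simpa using h1
      · simp only [Prod.snd_add]; linarith
    have hcover : tailX C 0 n x' ≤ J * m + m := by
      calc tailX C 0 n x'
          ≤ (law C 0 n).real ((⋃ j ∈ Finset.range J, F j) ∪ {u | x' < u.1 ∧ y < u.2}) := by
            refine ENNReal.toReal_mono (measure_ne_top _ _) (measure_mono_ae ?_)
            filter_upwards [ae_mem_law hC he n] with u hu h1
            by_cases h2 : y < u.2
            · exact Or.inr ⟨h1, h2⟩
            · refine Or.inl ?_
              have hbu : b ≤ u.2 := hb ⟨u, hu, rfl⟩
              have hnn : 0 ≤ (y - u.2) / s := div_nonneg (by linarith) hs0.le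
              have h3 := Nat.floor_le hnn
              have h4 := Nat.lt_floor_add_one ((y - u.2) / s)
              rw [le_div_iff₀ hs0] at h3
              rw [div_lt_iff₀ hs0] at h4
              refine Set.mem_biUnion (x := ⌊(y - u.2) / s⌋₊) ?_
                ⟨h1, by linarith, by linarith⟩
              simp only [Finset.coe_range, Set.mem_Iio]
              rw [Nat.floor_lt hnn, div_lt_iff₀ hs0]
              linarith
        _ ≤ (law C 0 n).real (⋃ j ∈ Finset.range J, F j) + m := measureReal_union_le _ _
        _ ≤ ∑ j ∈ Finset.range J, (law C 0 n).real (F j) + m := by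
            gcongr
            exact measureReal_biUnion_finset_le _ _
        _ ≤ ∑ _j ∈ Finset.range J, m + m := by
            gcongr with j
            exact hFm j
        _ = J * m + m := by simp
    have hd : 1 / 4 ≤ (law C 0 n).real {u | u.1 ≤ x' ∧ u.2 ≤ y} := by
      have h1 : (1 : ℝ) ≤ (law C 0 n).real {u | u.1 ≤ x' ∧ u.2 ≤ y} + tailX C 0 n x' +
          tailY C 0 n y := by
        rw [← probReal_univ (μ := law C 0 n)]
        have hcov : (Set.univ : Set (ℝ × ℝ)) ⊆
            ({u | u.1 ≤ x' ∧ u.2 ≤ y} ∪ {u | x' < u.1}) ∪ {u | y < u.2} := by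
          intro u _
          by_cases h1 : x' < u.1
          · exact Or.inl (Or.inr h1)
          by_cases h2 : y < u.2
          · exact Or.inr h2
          · exact Or.inl (Or.inl ⟨not_lt.1 h1, not_lt.1 h2⟩)
        refine (measureReal_mono hcov).trans ((measureReal_union_le _ _).trans ?_)
        gcongr
        · exact measureReal_union_le _ _
        · exact le_rfl
      linarith [hty n]
    have hmκ : 4 * κ ≤ m := by
      rw [hκ, mul_one_div, div_le_iff₀ (by positivity)]
      linarith
    have := tailY_zero_succ_ge hC n x' y
    have h6 : κ ≤ m * (law C 0 n).real {u | u.1 ≤ x' ∧ u.2 ≤ y} := by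
      nlinarith [mul_le_mul hmκ hd (by norm_num) (by linarith)]
    linarith
  have hlin (k : ℕ) : k * κ ≤ tailY C 0 (N + k) y := by
    induction k with
    | zero => simpa using tailY_nonneg N y
    | succ k ih =>
      have := hinc (N + k) (by omega)
      rw [← add_assoc]
      push_cast
      linarith
  obtain ⟨k, hk⟩ := exists_nat_gt (1 / κ)
  rw [div_lt_iff₀ hκ0] at hk
  linarith [hlin k, hty (N + k)]

/-! ### The point selected by the thresholds -/

/-- The feasible points at which both players receive at least their thresholds. -/
def critSet (C : Set (ℝ × ℝ)) (e : ℝ) : Set (ℝ × ℝ) := {u ∈ C | critX C e ≤ u.1 ∧ critY C e ≤ u.2}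

lemma snd_le_critY (hC : IsBargainingSet C) (he : |e| ≤ 1) {v : ℝ × ℝ}
    (hv : v ∈ C) (hmax : ∀ u ∈ C, u.1 ≤ v.1) (hx : v.1 ≤ critX C e) : v.2 ≤ critY C e := by
  rcases eq_or_ne e 0 with rfl | he0
  exacts [snd_le_critY_zero hC hv hmax hx, snd_le_critY_of_ne_zero hC he he0 hv hmax hx]

lemma critX_swap (C : Set (ℝ × ℝ)) (e : ℝ) : critX (Prod.swap '' C) (-e) = critY C e := rfl

lemma critY_swap (C : Set (ℝ × ℝ)) (e : ℝ) : critY (Prod.swap '' C) (-e) = critX C e := by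
  unfold critY
  rw [Set.image_image, neg_neg]
  simp

lemma snd_le_of_mem_critSet (hC : IsBargainingSet C) (he : |e| ≤ 1) {u v : ℝ × ℝ}
    (hu : u ∈ critSet C e) (hv : v ∈ critSet C e) : v.2 ≤ u.2 := by
  by_contra! h
  have hvy : critY C e < v.2 := hu.2.2.trans_lt h
  have hvx : v.1 ≤ critX C e := by
    by_contra! h'
    exact not_le.2 hvy (not_crit_lt hC he hv.1 h')
  refine not_le.2 hvy (snd_le_critY hC he hv.1 (fun w hw => ?_) hvx)
  -- A point on the right of `v` could be combined with `v` to a point above both thresholds.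
  by_contra! hlt
  have hcont : Tendsto (fun θ : ℝ => (1 - θ) * v.2 + θ * w.2) (𝓝[>] 0) (𝓝 v.2) := by
    have : Continuous fun θ : ℝ => (1 - θ) * v.2 + θ * w.2 := by fun_prop
    simpa using (this.tendsto 0).mono_left nhdsWithin_le_nhds
  obtain ⟨θ, h1, h2, h3⟩ := ((hcont.eventually_const_lt hvy).and
    (Ioo_mem_nhdsGT (zero_lt_one' ℝ))).exists
  have hmem := hC.convex hv.1 hw (sub_nonneg.2 h3.le) h2.le (by ring)
  refine not_le.2 h1 (not_crit_lt hC he hmem ?_)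
  simp only [Prod.fst_add, Prod.smul_fst, smul_eq_mul]
  nlinarith [hv.2.1]

lemma swap_mem_critSet {u : ℝ × ℝ} (hu : u ∈ critSet C e) :
    u.swap ∈ critSet (Prod.swap '' C) (-e) :=
  ⟨⟨u, hu.1, rfl⟩, hu.2.2, (critY_swap C e).trans_le hu.2.1⟩

/-- Two points of `critSet` have equal coordinates: the second ones agree because `critSet` contains
no piece of a vertical edge, and the first ones by the same argument with the players exchanged. -/
lemma critSet_subsingleton (hC : IsBargainingSet C) (he : |e| ≤ 1) :
    (critSet C e).Subsingleton := by
  intro u hu v hv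
  have he' : |-e| ≤ 1 := by rwa [abs_neg]
  have h1 := snd_le_of_mem_critSet hC.swap he' (swap_mem_critSet hu) (swap_mem_critSet hv)
  have h2 := snd_le_of_mem_critSet hC.swap he' (swap_mem_critSet hv) (swap_mem_critSet hu)
  exact Prod.ext (le_antisymm h2 h1) (le_antisymm (snd_le_of_mem_critSet hC he hv hu)
    (snd_le_of_mem_critSet hC he hu hv))

/-! ### Concentration -/

lemma exists_forall_mem_of_isCompact (hC : IsCompact C) {U : Set (ℝ × ℝ)} (hU : IsOpen U)
    {a b : ℝ} (h : ∀ u ∈ C, a ≤ u.1 → b ≤ u.2 → u ∈ U) :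
    ∃ δ > 0, ∀ u ∈ C, a - δ < u.1 → b - δ < u.2 → u ∈ U := by
  rcases (C \ U).eq_empty_or_nonempty with hne | hne
  · exact ⟨1, one_pos, fun u hu _ _ => by_contra fun h' => hne.subset ⟨hu, h'⟩⟩
  obtain ⟨w, hw, hmax⟩ := (hC.diff hU).exists_isMaxOn hne
    (f := fun u : ℝ × ℝ => min (u.1 - a) (u.2 - b)) (by fun_prop)
  have hneg : min (w.1 - a) (w.2 - b) < 0 := by
    by_contra! h'
    have := le_min_iff.1 h'
    exact hw.2 (h w hw.1 (by linarith) (by linarith))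
  refine ⟨-min (w.1 - a) (w.2 - b), by linarith, fun u hu h1 h2 => by_contra fun h' => ?_⟩
  have h3 : min (u.1 - a) (u.2 - b) ≤ min (w.1 - a) (w.2 - b) := hmax ⟨hu, h'⟩
  exact not_lt.2 h3 (lt_min (by linarith) (by linarith))

lemma tendsto_law_of_critSet_subset (hC : IsBargainingSet C) (he : |e| ≤ 1) (he0 : e ≠ 0)
    {U : Set (ℝ × ℝ)} (hU : IsOpen U) (h : critSet C e ⊆ U) :
    Tendsto (fun n => law C e n U) atTop (𝓝 1) := by
  obtain ⟨δ, hδ, hδU⟩ := exists_forall_mem_of_isCompact hC.isCompact hU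
    (fun u hu h1 h2 => h ⟨hu, h1, h2⟩)
  have h1 := tendsto_tailX_one hC he he0 (sub_lt_self (critX C e) hδ)
  have h2 := tendsto_tailY_one hC he he0 (sub_lt_self (critY C e) hδ)
  have hlow : Tendsto (fun n => tailX C e n (critX C e - δ) + tailY C e n (critY C e - δ) - 1)
      atTop (𝓝 1) := by
    simpa using (h1.add h2).sub_const 1
  have hreal : Tendsto (fun n => (law C e n).real U) atTop (𝓝 1) := by
    refine tendsto_of_tendsto_of_tendsto_of_le_of_le hlow tendsto_const_nhds (fun n => ?_)
      (fun n => ?_)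
    · have := isProbabilityMeasure_law hC he n
      have h3 : (law C e n).real Set.univ ≤
          (law C e n).real ((U ∪ {u | u.1 ≤ critX C e - δ}) ∪ {u | u.2 ≤ critY C e - δ}) := by
        refine ENNReal.toReal_mono (measure_ne_top _ _) (measure_mono_ae ?_)
        filter_upwards [ae_mem_law hC he n] with u hu _
        by_cases h1 : u.1 ≤ critX C e - δ
        · exact Or.inl (Or.inr h1)
        by_cases h2 : u.2 ≤ critY C e - δ
        · exact Or.inr h2
        · exact Or.inl (Or.inl (hδU u hu (not_le.1 h1) (not_le.1 h2)))
      have h4 := measureReal_union_le (μ := law C e n) (U ∪ {u | u.1 ≤ critX C e - δ})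
        {u | u.2 ≤ critY C e - δ}
      have h5 := measureReal_union_le (μ := law C e n) U {u | u.1 ≤ critX C e - δ}
      rw [probReal_univ] at h3
      rw [law_real_fst_le hC he] at h5
      rw [law_real_snd_le hC he] at h4
      linarith
    · have := isProbabilityMeasure_law hC he n
      exact measureReal_le_one
  have := ENNReal.tendsto_ofReal hreal
  rw [ENNReal.ofReal_one] at this
  refine this.congr fun n => ?_
  have := isProbabilityMeasure_law hC he n
  exact ofReal_measureReal

lemma critSet_nonempty (hC : IsBargainingSet C) (he : |e| ≤ 1) (he0 : e ≠ 0) :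
    (critSet C e).Nonempty := by
  by_contra! h
  have := tendsto_law_of_critSet_subset hC he he0 isOpen_empty h.subset
  simp [tendsto_const_nhds_iff] at this

lemma concentratesAround_of_mem_critSet (hC : IsBargainingSet C) {ε : ℝ}
    (hε : ε ∈ Set.Ioc (0 : ℝ) (1 / 2)) {c : ℝ × ℝ} (hc : c ∈ critSet C (2 * ε)) :
    ConcentratesAround (valueLaw C ε) c := by
  have he := abs_two_mul_le hε
  have he0 : 2 * ε ≠ 0 := by linarith [hε.1]
  refine ⟨fun n => ⟨law C (2 * ε) n, isProbabilityMeasure_law hC he n⟩,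
    fun n => (valueLaw_eq hC hε n).symm, ?_⟩
  refine tendsto_of_forall_isOpen_le_liminf' fun G hG => ?_
  by_cases hcG : c ∈ G
  · have hsub : critSet C (2 * ε) ⊆ G := fun u hu => by
      rwa [critSet_subsingleton hC he hu hc]
    have hlim := tendsto_law_of_critSet_subset hC he he0 hG hsub
    exact prob_le_one.trans hlim.liminf_eq.ge
  · rw [diracProba_toMeasure_apply]
    simp [hcG]

/-! ### The limit of vanishing bias -/

lemma eventually_le_critX (hC : IsBargainingSet C) {x : ℝ} (hx : x < critX C 0) :
    ∀ᶠ e in 𝓝 (0 : ℝ), x ≤ critX C e := by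
  obtain ⟨n, hn⟩ := exists_excess_pos_of_lt_critX hC (e := 0) (by simp) hx
  rw [bias_zero, excess_zero] at hn
  have hcont : Continuous fun e : ℝ =>
      2 * ((1 - |e|) ^ (2 ^ n - 1) * tailX C 0 n x) - 1 - |e| := by fun_prop
  have hpos := (hcont.tendsto 0).eventually_const_lt (u := 0) (by simpa using hn)
  have habs : ∀ᶠ e in 𝓝 (0 : ℝ), |e| < 1 :=
    (continuous_abs.tendsto (0 : ℝ)).eventually_lt_const (by simp)
  filter_upwards [hpos, habs] with e hpos he
  have hI := tailX_mem_Icc hC he.le n x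
  have hle : (1 - |e|) ^ (2 ^ n - 1) * tailX C 0 n x ≤ tailX C e n x := by
    have := isProbabilityMeasure_law hC he.le n
    have h := ENNReal.toReal_mono (measure_ne_top _ _) (smul_law_zero_le hC he.le n {u | x < u.1})
    rw [Measure.smul_apply, smul_eq_mul, ENNReal.toReal_mul,
      ENNReal.toReal_ofReal (pow_nonneg (sub_nonneg.2 he.le) _)] at h
    exact h
  refine le_critX_of_excess_pos hC he.le (n := n) ?_
  have hr : tailX C e n x * (1 - tailX C e n x) ≤ 1 := by nlinarith [hI.1, hI.2]
  have hb : -|e| ≤ bias e n := (abs_le.1 (abs_bias e n).le).1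
  have hr0 := mul_nonneg hI.1 (sub_nonneg.2 hI.2)
  unfold excess
  nlinarith [mul_le_mul_of_nonneg_right hb hr0, mul_le_mul_of_nonneg_left hr (abs_nonneg e)]

lemma eventually_le_critY (hC : IsBargainingSet C) {y : ℝ} (hy : y < critY C 0) :
    ∀ᶠ e in 𝓝 (0 : ℝ), y ≤ critY C e := by
  have h := eventually_le_critX hC.swap (x := y) (by rwa [← neg_zero, critX_swap])
  exact (continuous_neg.tendsto' (0 : ℝ) 0 neg_zero).eventually h

lemma exists_isREFSolution (hC : IsBargainingSet C) :
    ∃ z ∈ critSet C 0, IsREFSolution C z := by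
  have hex (ε : ℝ) : ∃ c, ε ∈ Set.Ioc (0 : ℝ) (1 / 2) → c ∈ critSet C (2 * ε) := by
    by_cases hε : ε ∈ Set.Ioc (0 : ℝ) (1 / 2)
    · obtain ⟨c, hc⟩ := critSet_nonempty hC (abs_two_mul_le hε)
        (show 2 * ε ≠ 0 by linarith [hε.1])
      exact ⟨c, fun _ => hc⟩
    · exact ⟨0, fun h => absurd h hε⟩
  choose c hc using hex
  have hIoc : ∀ᶠ ε : ℝ in 𝓝[>] 0, ε ∈ Set.Ioc (0 : ℝ) (1 / 2) :=
    Ioc_mem_nhdsGT (by norm_num)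
  have htwo : Tendsto (fun ε : ℝ => 2 * ε) (𝓝[>] 0) (𝓝 0) :=
    ((continuous_const_mul (2 : ℝ)).tendsto' 0 0 (by simp)).mono_left nhdsWithin_le_nhds
  have hU {U : Set (ℝ × ℝ)} (hU : IsOpen U) (h : critSet C 0 ⊆ U) : ∀ᶠ ε in 𝓝[>] 0, c ε ∈ U := by
    obtain ⟨δ, hδ, hδU⟩ := exists_forall_mem_of_isCompact hC.isCompact hU
      (fun u hu h1 h2 => h ⟨hu, h1, h2⟩)
    have h1 := htwo.eventually (eventually_le_critX hC
      (show critX C 0 - δ / 2 < critX C 0 by linarith))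
    have h2 := htwo.eventually (eventually_le_critY hC
      (show critY C 0 - δ / 2 < critY C 0 by linarith))
    filter_upwards [h1, h2, hIoc] with ε h1 h2 hε
    have h3 := hc ε hε
    exact hδU _ h3.1 (by linarith [h3.2.1]) (by linarith [h3.2.2])
  obtain ⟨z, hz⟩ : (critSet C 0).Nonempty := by
    by_contra! h
    obtain ⟨ε, hε⟩ := (hU isOpen_empty h.subset).exists
    exact hε
  refine ⟨z, hz, c, fun ε hε => concentratesAround_of_mem_critSet hC hε (hc ε hε), ?_⟩
  refine tendsto_nhds.2 fun U hUo hzU => hU hUo fun u hu => ?_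
  rwa [critSet_subsingleton hC (by simp) hu hz]

/-! ### The solution and its properties -/

lemma ConcentratesAround.unique {μ : ℕ → Measure (ℝ × ℝ)} {c c' : ℝ × ℝ}
    (h : ConcentratesAround μ c) (h' : ConcentratesAround μ c') : c = c' := by
  obtain ⟨ν, hν, hlim⟩ := h
  obtain ⟨ν', hν', hlim'⟩ := h'
  obtain rfl : ν = ν' := funext fun n => Subtype.ext ((hν n).trans (hν' n).symm)
  exact injective_diracProba (tendsto_nhds_unique hlim hlim')

lemma ConcentratesAround.map {μ : ℕ → Measure (ℝ × ℝ)} {c : ℝ × ℝ} (h : ConcentratesAround μ c)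
    {f : ℝ × ℝ → ℝ × ℝ} (hf : Continuous f) :
    ConcentratesAround (fun n => (μ n).map f) (f c) := by
  obtain ⟨ν, hν, hlim⟩ := h
  refine ⟨fun n => (ν n).map hf.measurable.aemeasurable, fun n => ?_, ?_⟩
  · exact congrArg (Measure.map f) (hν n)
  · have := ProbabilityMeasure.tendsto_map_of_tendsto_of_continuous _ _ hlim hf
    convert this using 2
    refine Subtype.ext ?_
    exact (Measure.map_dirac' hf.measurable c).symm

lemma IsREFSolution.unique {z z' : ℝ × ℝ} (h : IsREFSolution C z) (h' : IsREFSolution C z') :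
    z = z' := by
  obtain ⟨c, hc, hlim⟩ := h
  obtain ⟨c', hc', hlim'⟩ := h'
  have heq : c =ᶠ[𝓝[>] 0] c' := by
    filter_upwards [Ioc_mem_nhdsGT (show (0 : ℝ) < 1 / 2 by norm_num)] with ε hε
    exact (hc ε hε).unique (hc' ε hε)
  exact tendsto_nhds_unique hlim (hlim'.congr' heq.symm)

lemma IsREFSolution.refSolution_eq {z : ℝ × ℝ} (h : IsREFSolution C z) : refSolution C = z :=
  (Classical.epsilon_spec ⟨z, h⟩ : IsREFSolution C (refSolution C)).unique h

lemma IsREFSolution.affine (hC : IsBargainingSet C) {z : ℝ × ℝ} (h : IsREFSolution C z)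
    {a₁ a₂ : ℝ} (h₁ : 0 < a₁) (h₂ : 0 < a₂) (b₁ b₂ : ℝ) :
    IsREFSolution ((fun u : ℝ × ℝ => (a₁ * u.1 + b₁, a₂ * u.2 + b₂)) '' C)
      (a₁ * z.1 + b₁, a₂ * z.2 + b₂) := by
  obtain ⟨c, hc, hlim⟩ := h
  have hf : Continuous fun u : ℝ × ℝ => (a₁ * u.1 + b₁, a₂ * u.2 + b₂) := by fun_prop
  refine ⟨fun ε => (a₁ * (c ε).1 + b₁, a₂ * (c ε).2 + b₂), fun ε hε => ?_,
    (hf.tendsto z).comp hlim⟩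
  have heq : valueLaw ((fun u : ℝ × ℝ => (a₁ * u.1 + b₁, a₂ * u.2 + b₂)) '' C) ε =
      fun n => (valueLaw C ε n).map fun u : ℝ × ℝ => (a₁ * u.1 + b₁, a₂ * u.2 + b₂) := by
    funext n
    rw [valueLaw_eq (hC.affine h₁.ne' h₂.ne' b₁ b₂) hε, valueLaw_eq hC hε,
      law_affine hC (abs_two_mul_le hε) h₁ h₂]
  rw [heq]
  exact (hc ε hε).map hf

lemma refSolution_mem_critSet (hC : IsBargainingSet C) : refSolution C ∈ critSet C 0 := by
  obtain ⟨z, hz, h⟩ := exists_isREFSolution hC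
  rwa [h.refSolution_eq]

lemma isStandardSolution_refSolution : IsStandardSolution refSolution where
  paretoEfficient C hC := by
    have hz := refSolution_mem_critSet hC
    exact ⟨hz.1, fun w hw h1 h2 => critSet_subsingleton hC (by simp)
      ⟨hw, hz.2.1.trans h1, hz.2.2.trans h2⟩ hz⟩
  symmetric C hC hsymm := by
    have hz := refSolution_mem_critSet hC
    have hz' := swap_mem_critSet hz
    rw [hsymm, neg_zero] at hz'
    exact congrArg Prod.fst (critSet_subsingleton hC (by simp) hz hz')
  affineInvariant C hC a₁ a₂ b₁ b₂ h₁ h₂ := by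
    obtain ⟨z, -, h⟩ := exists_isREFSolution hC
    rw [h.refSolution_eq]
    exact (h.affine hC h₁ h₂ b₁ b₂).refSolution_eq

end RandomGame

end


theorem mainTheorem2 :
    (∀ C : Set (ℝ × ℝ), RandomGame.IsBargainingSet C →
      ∀ ε ∈ Set.Ioc (0 : ℝ) (1 / 2), ∀ n : ℕ,
        ∀ᵐ G ∂(RandomGame.hybridGame C ε n), ∃! σ, RandomGame.IsSPE G σ) ∧
    (∀ C : Set (ℝ × ℝ), RandomGame.IsBargainingSet C →
      ∃! z : ℝ × ℝ, RandomGame.IsREFSolution C z) ∧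
    RandomGame.IsStandardSolution RandomGame.refSolution := by
  refine ⟨fun C hC ε hε n => ?_, fun C hC => ?_, RandomGame.isStandardSolution_refSolution⟩
  · exact (RandomGame.ae_isGeneric hC hε n).mono fun _ h => h.existsUnique_isSPE
  · obtain ⟨z, -, h⟩ := RandomGame.exists_isREFSolution hC
    exact ⟨z, h, fun _ h' => h'.unique h⟩
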